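/- Work over $\mathbb{C}$. Let $\ell_1,\ell_2,\ell_3\in\mathbb{C}[x_0,x_1,x_2]$ be linear forms and $g\in\mathbb{C}[x_0,x_1,x_2]$ a cubic form such that the cubic threefold $$X=V\bigl(\ell_1x_3^2+\ell_2x_4^2+2\ell_3x_3x_4+g\bigr)\subset\mathbb{P}^4$$ is smooth; this is the normal form of a smooth cubic threefold with an involution $\tau:[x_0,\dots,x_4]\mapsto[x_0,x_1,x_2,-x_3,-x_4]$ of non-Eckardt type. Let $L=V(x_0,x_1,x_2)\subset X$ be the line fixed pointwise by $\tau$, let $\pi_L:\mathrm{Bl}_LX\to\mathbb{P}^2_{x_0,x_1,x_2}$ be the conic fibration given by projection from $L$ (where $\mathrm{Bl}_LX$ is the strict transform of $X$ in $\mathrm{Bl}_L\mathbb{P}^4\subset\mathbb{P}^4\times\mathbb{P}^2$), and let $D_L\subset\mathbb{P}^2$ be its discriminant curve, the vanishing locus of the determinant of $$M=\begin{pmatrix}\ell_1&\ell_3&0\\ \ell_3&\ell_2&0\\ 0&0&g\end{pmatrix}.$$ Put $C=V(g)$ and $Q=V(\ell_1\ell_2-\ell_3^2)$ in $\mathbb{P}^2$.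 The discriminant double cover of $D_L$ is $$\widetilde D_L=\{(p,m): p\in D_L,\ m \text{ a line contained in the fibre } \pi_L^{-1}(p)\}\longrightarrow D_L .$$ Let $\pi:\widetilde C\to C$ be its restriction to $C$, where $\widetilde C=\{(p,m)\in\widetilde D_L: p\in C\}$ is regarded as a (reduced) variety in $\mathbb{P}^2\times G(2,5)$. Then: 1. $C$ is smooth and $D_L=C\cup Q$. 2. $\pi:\widetilde C\to C$ is a double cover, that is, a finite flat morphism of degree $2$, and its branch points (the points whose fibre does not consist of two points) are exactly the points of $C\cap Q$. 3. The line bundle associated with $\pi$ is $\mathcal{L}=\mathcal{O}_C(1)$: there is an isomorphism of sheaves of $\mathcal{O}_C$-algebras $$\pi_*\mathcal{O}_{\widetilde C}\;\cong\;\mathcal{O}_C\oplus\mathcal{O}_C(-1),$$ where the product of two local sections $t,t'$ of $\mathcal{O}_C(-1)=\mathcal{L}^{-1}$ is $s\,t\,t'\in\mathcal{O}_C$, with $s=(\ell_1\ell_2-\ell_3^2)|_C\in H^0(C,\mathcal{O}_C(2))=H^0(C,\mathcal{L}^{2})$. -/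

import Mathlib

open MvPolynomial
open scoped LinearAlgebra.Projectivization Topology

/-! ### Complex varieties in homogeneous coordinates

A variety is a set of points with (multi)homogeneous coordinates. Its Zariski topology, its sheaf of
regular functions and its sheaves `𝒪(d)` are the classical ones: local quotients of homogeneous
polynomials in the coordinates. -/

/-- (Multi)homogeneous coordinates, indexed by `σ` and graded by `M`, on a set of points `Y`:
`cone y` is the set of all coordinate vectors of the point `y`. -/
structure HomCoords (Y σ M : Type) where
  wt : σ → M
  cone : Y → Set (σ → ℂ)

namespace HomCoords

variable {Y σ M Y' σ' M' : Type}

/-- The coordinates induced on a subset. -/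
def restrict (H : HomCoords Y σ M) (S : Set Y) : HomCoords S σ M where
  wt := H.wt
  cone y := H.cone y.1

/-- The product of two varieties, with its multihomogeneous coordinates. -/
def prod [Zero M] [Zero M'] (H : HomCoords Y σ M) (H' : HomCoords Y' σ' M') :
    HomCoords (Y × Y') (σ ⊕ σ') (M × M') where
  wt := Sum.elim (fun i => (H.wt i, 0)) (fun j => (0, H'.wt j))
  cone y := {z | (fun i => z (Sum.inl i)) ∈ H.cone y.1 ∧ (fun j => z (Sum.inr j)) ∈ H'.cone y.2}

/-- The Zariski topology: the non-vanishing loci of homogeneous polynomials generate the opens. -/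
abbrev zariski [AddCommGroup M] (H : HomCoords Y σ M) : TopologicalSpace Y :=
  TopologicalSpace.generateFrom
    {D | ∃ (k : M) (B : MvPolynomial σ ℂ), IsWeightedHomogeneous H.wt B k ∧
      D = {y | ∀ x ∈ H.cone y, eval x B ≠ 0}}

/-- The cone over `V`: points of `V` together with one of their coordinate vectors. -/
abbrev ConeOver (H : HomCoords Y σ M) (V : Set Y) : Type := Σ y : V, H.cone y.1

/-- Sections of `𝒪(d)` over `V`: functions on the cone over `V` which locally are quotients `A / B`
of homogeneous polynomials with `deg A = deg B + d`. -/
def sections [AddCommGroup M] (H : HomCoords Y σ M) (d : M) (V : Set Y) :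
    Submodule ℂ (H.ConeOver V → ℂ) where
  carrier := {s | ∀ y : V, ∃ (k : M) (A B : MvPolynomial σ ℂ),
    IsWeightedHomogeneous H.wt A (k + d) ∧ IsWeightedHomogeneous H.wt B k ∧
    (∀ x ∈ H.cone y.1, eval x B ≠ 0) ∧
    ∀ z : H.ConeOver V, eval z.2.1 B ≠ 0 → s z = eval z.2.1 A / eval z.2.1 B}
  zero_mem' := fun y => ⟨0, 0, 1, isWeightedHomogeneous_zero _ _ _,
    isWeightedHomogeneous_one _ _, by simp, by simp⟩
  add_mem' := by
    intro s t hs ht y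
    obtain ⟨k, A, B, hA, hB, h0, h⟩ := hs y
    obtain ⟨k', A', B', hA', hB', h0', h'⟩ := ht y
    refine ⟨k + k', A * B' + A' * B, B * B', ?_, hB.mul hB', ?_, ?_⟩
    · refine IsWeightedHomogeneous.add ?_ ?_
      · have := hA.mul hB'
        rwa [show k + d + k' = k + k' + d by abel] at this
      · have := hA'.mul hB
        rwa [show k' + d + k = k + k' + d by abel] at this
    · intro x hx
      simpa using ⟨h0 x hx, h0' x hx⟩
    · intro z hz
      have hz1 : eval z.2.1 B ≠ 0 := fun e => hz (by simp [e])
      have hz2 : eval z.2.1 B' ≠ 0 := fun e => hz (by simp [e])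
      simp only [Pi.add_apply, h z hz1, h' z hz2, map_add, map_mul]
      field_simp
  smul_mem' := by
    intro c s hs y
    obtain ⟨k, A, B, hA, hB, h0, h⟩ := hs y
    refine ⟨k, C c * A, B, ?_, hB, h0, ?_⟩
    · have := (isWeightedHomogeneous_C H.wt c).mul hA
      rwa [zero_add] at this
    · intro z hz
      simp only [Pi.smul_apply, h z hz, map_mul, eval_C, smul_eq_mul, mul_div_assoc]

/-- The `ℂ`-algebra of regular functions on `V`: functions on points that are sections of `𝒪(0)`. -/
def regular [AddCommGroup M] (H : HomCoords Y σ M) (V : Set Y) : Subalgebra ℂ (V → ℂ) where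
  carrier := {f | (fun z : H.ConeOver V => f z.1) ∈ H.sections 0 V}
  add_mem' := fun {f g} hf hg => (H.sections 0 V).add_mem hf hg
  mul_mem' := by
    intro f g hf hg y
    obtain ⟨k, A, B, hA, hB, h0, h⟩ := hf y
    obtain ⟨k', A', B', hA', hB', h0', h'⟩ := hg y
    refine ⟨k + k', A * A', B * B', ?_, hB.mul hB', ?_, ?_⟩
    · have := hA.mul hA'
      rwa [show k + 0 + (k' + 0) = k + k' + 0 by abel] at this
    · intro x hx
      simpa using ⟨h0 x hx, h0' x hx⟩
    · intro z hz
      have hz1 : eval z.2.1 B ≠ 0 := fun e => hz (by simp [e])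
      have hz2 : eval z.2.1 B' ≠ 0 := fun e => hz (by simp [e])
      have e1 := h z hz1
      have e2 := h' z hz2
      simp only [Pi.mul_apply, map_mul] at e1 e2 ⊢
      rw [e1, e2, div_mul_div_comm]
  algebraMap_mem' := fun c y => ⟨0, C c, 1, by
    rw [add_zero]; exact isWeightedHomogeneous_C H.wt c,
    isWeightedHomogeneous_one _ _, by simp, by intro z _; simp⟩

/-- Morphisms of varieties: continuous maps that pull regular functions back to regular functions. -/
def IsMorphism [AddCommGroup M] [AddCommGroup M'] (H : HomCoords Y σ M) (H' : HomCoords Y' σ' M')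
    (f : Y → Y') : Prop :=
  Continuous[H.zariski, H'.zariski] f ∧
    ∀ V : Set Y', IsOpen[H'.zariski] V → ∀ h ∈ H'.regular V,
      (fun y : f ⁻¹' V => h ⟨f y.1, y.2⟩) ∈ H.regular (f ⁻¹' V)

/-- Affine space `𝔸ⁿ` (all coordinates have weight zero). -/
def affineSpace (n : ℕ) : HomCoords (Fin n → ℂ) (Fin n) ℤ where
  wt := fun _ => 0
  cone y := {y}

/-- A variety is affine if it is isomorphic to a closed subvariety of some `𝔸ⁿ`. -/
def IsAffine [AddCommGroup M] (H : HomCoords Y σ M) : Prop :=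
  ∃ (n : ℕ) (Z : Set (Fin n → ℂ)), IsClosed[(affineSpace n).zariski] Z ∧
    ∃ e : Y ≃ Z, IsMorphism H ((affineSpace n).restrict Z) e ∧
      IsMorphism ((affineSpace n).restrict Z) H e.symm

/-- Projective space `ℙⁿ⁻¹` with its `n` homogeneous coordinates. -/
def projSpace (n : ℕ) : HomCoords (ℙ ℂ (Fin n → ℂ)) (Fin n) ℤ where
  wt := fun _ => 1
  cone p := {x | x ≠ 0 ∧ x ∈ p.submodule}

/-- A double cover: a finite flat morphism of degree two, that is, locally on the base an affine
morphism such that `π_* 𝒪` is a free module of rank two. -/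
def IsDoubleCover [AddCommGroup M] [AddCommGroup M'] (H : HomCoords Y σ M)
    (H' : HomCoords Y' σ' M') (π : Y → Y') : Prop :=
  IsMorphism H H' π ∧ ∀ p : Y', ∃ V : Set Y', p ∈ V ∧ IsOpen[H'.zariski] V ∧
    IsAffine (H'.restrict V) ∧ IsAffine (H.restrict (π ⁻¹' V)) ∧
    ∃ e₁ ∈ H.regular (π ⁻¹' V), ∃ e₂ ∈ H.regular (π ⁻¹' V), ∀ h ∈ H.regular (π ⁻¹' V),
      ∃! ab : H'.regular V × H'.regular V, ∀ y : (π ⁻¹' V : Set Y),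
        h y = ab.1.1 ⟨π y.1, y.2⟩ * e₁ y + ab.2.1 ⟨π y.1, y.2⟩ * e₂ y

/-- An isomorphism of sheaves of `𝒪`-algebras `π_* 𝒪_Y ≅ 𝒪 ⊕ 𝓛⁻¹` over the base `Y'`, where
`𝓛 = 𝒪(d)` and where the product of two sections of `𝓛⁻¹` is `t · t' = s t t'` for a given global
section `s` of `𝓛²`. It is given by its restriction `φ` to the summand `𝓛⁻¹ = 𝒪(-d)`. -/
structure Splitting [AddCommGroup M] [AddCommGroup M'] (H : HomCoords Y σ M)
    (H' : HomCoords Y' σ' M') (π : Y → Y') (d : M') (s : H'.sections (d + d) Set.univ) where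
  φ : ∀ V : Set Y', IsOpen[H'.zariski] V → (H'.sections (-d) V →ₗ[ℂ] H.regular (π ⁻¹' V))
  /-- compatibility with restriction to smaller open sets -/
  restriction : ∀ (V W : Set Y') (hV : IsOpen[H'.zariski] V) (hW : IsOpen[H'.zariski] W)
    (hWV : W ⊆ V) (t : H'.sections (-d) V) (t' : H'.sections (-d) W),
    (∀ z : H'.ConeOver W, t'.1 z = t.1 ⟨⟨z.1.1, hWV z.1.2⟩, z.2⟩) →
    ∀ y : (π ⁻¹' W : Set Y), (φ W hW t').1 y = (φ V hV t).1 ⟨y.1, hWV y.2⟩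
  /-- linearity over the regular functions of the base -/
  linear : ∀ (V : Set Y') (hV : IsOpen[H'.zariski] V) (f : H'.regular V)
    (t t' : H'.sections (-d) V), (∀ z : H'.ConeOver V, t'.1 z = f.1 z.1 * t.1 z) →
    ∀ y : (π ⁻¹' V : Set Y), (φ V hV t').1 y = f.1 ⟨π y.1, y.2⟩ * (φ V hV t).1 y
  /-- the product of two sections of the second summand is given by `s` -/
  mul : ∀ (V : Set Y') (hV : IsOpen[H'.zariski] V) (t t' : H'.sections (-d) V)
    (y : (π ⁻¹' V : Set Y)) (x : H'.cone (π y.1)),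
    (φ V hV t).1 y * (φ V hV t').1 y =
      s.1 ⟨⟨π y.1, trivial⟩, x⟩ * t.1 ⟨⟨π y.1, y.2⟩, x⟩ * t'.1 ⟨⟨π y.1, y.2⟩, x⟩
  /-- `𝒪 ⊕ 𝓛⁻¹ → π_* 𝒪_Y` is bijective -/
  bijective : ∀ (V : Set Y') (hV : IsOpen[H'.zariski] V), ∀ h ∈ H.regular (π ⁻¹' V),
    ∃! ft : H'.regular V × H'.sections (-d) V, ∀ y : (π ⁻¹' V : Set Y),
      h y = ft.1.1 ⟨π y.1, y.2⟩ + (φ V hV ft.2).1 y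

/-- The double cover `π` is associated with the line bundle `𝒪(d)` and the section `s` of its
square. -/
def IsAssociatedWith [AddCommGroup M] [AddCommGroup M'] (H : HomCoords Y σ M)
    (H' : HomCoords Y' σ' M') (π : Y → Y') (d : M') (s : H'.sections (d + d) Set.univ) : Prop :=
  Nonempty (Splitting H H' π d s)

end HomCoords

/-- The branch points of a double cover: the points whose fibre does not have two points. -/
def branchLocus {Y Y' : Type} (π : Y → Y') : Set Y' := {p | (π ⁻¹' {p}).ncard ≠ 2}

/-- The hypersurface in projective space defined by a homogeneous polynomial. -/
def hypersurface {n : ℕ} (P : MvPolynomial (Fin n) ℂ) : Set (ℙ ℂ (Fin n → ℂ)) :=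
  {p | ∀ x ∈ p.submodule, eval x P = 0}

/-- The Jacobian criterion for a projective hypersurface. -/
def IsSmoothHypersurface {n : ℕ} (P : MvPolynomial (Fin n) ℂ) : Prop :=
  ∀ x : Fin n → ℂ, x ≠ 0 → eval x P = 0 → ∃ i, eval x (pderiv i P) ≠ 0

/-- The lines in `ℙ⁴`. -/
abbrev LineP4 : Type := {m : Submodule ℂ (Fin 5 → ℂ) // Module.finrank ℂ m = 2}

/-- The Grassmannian of lines in `ℙ⁴` with its Plücker coordinates. -/
def grassmannian : HomCoords LineP4 (Fin 5 × Fin 5) ℤ where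
  wt := fun _ => 1
  cone m := {ω | ∃ v w : Fin 5 → ℂ, LinearIndependent ℂ ![v, w] ∧
    Submodule.span ℂ {v, w} = m.1 ∧ ω = fun ij => v ij.1 * w ij.2 - v ij.2 * w ij.1}

section ProjectionFromLine

/-- The first three of five coordinates: the linear projection from the line
`L = V(x₀, x₁, x₂) ⊂ ℙ⁴` to the plane `Π = V(x₃, x₄)` with coordinates `x₀, x₁, x₂`. -/
def projL (x : Fin 5 → ℂ) : Fin 3 → ℂ := fun i => x (Fin.castLE (by norm_num) i)

/-- The blow-up along `L` of a subset `X` of `ℙ⁴`: the strict transform of `X` in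
`Bl_L ℙ⁴ = {(x, p) ∈ ℙ⁴ × ℙ² | projL x ∈ p}`, that is, the closure of the preimage of `X \ L`. -/
def blowUpL (X : Set (ℙ ℂ (Fin 5 → ℂ))) : Set (ℙ ℂ (Fin 5 → ℂ) × ℙ ℂ (Fin 3 → ℂ)) :=
  @closure _ ((HomCoords.projSpace 5).prod (HomCoords.projSpace 3)).zariski
    {z | z.1 ∈ X ∧ (∃ x ∈ z.1.submodule, projL x ≠ 0) ∧
      ∀ x ∈ z.1.submodule, projL x ∈ z.2.submodule}

variable (l₁ l₂ l₃ g : MvPolynomial (Fin 3) ℂ)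

/-- `l₁ x₃² + l₂ x₄² + 2 l₃ x₃ x₄ + g`, with `l₁, l₂, l₃, g` polynomials in `x₀, x₁, x₂`. -/
noncomputable def threefoldEq : MvPolynomial (Fin 5) ℂ :=
  rename (Fin.castLE (by norm_num)) l₁ * X 3 ^ 2 + rename (Fin.castLE (by norm_num)) l₂ * X 4 ^ 2 +
    2 * rename (Fin.castLE (by norm_num)) l₃ * X 3 * X 4 + rename (Fin.castLE (by norm_num)) g

/-- The symmetric matrix of the conic fibration `Bl_L X → ℙ²`. -/
noncomputable def conicMatrix : Matrix (Fin 3) (Fin 3) (MvPolynomial (Fin 3) ℂ) :=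
  !![l₁, l₃, 0; l₃, l₂, 0; 0, 0, g]

/-- The discriminant curve `D_L` of the conic fibration. -/
noncomputable def discriminantCurve : Set (ℙ ℂ (Fin 3 → ℂ)) :=
  hypersurface (conicMatrix l₁ l₂ l₃ g).det

/-- The discriminant double cover: pairs of a point `p` of `D_L` and a line contained in the fibre
over `p` of the conic fibration `Bl_L X → ℙ²` (which is a conic in the plane spanned by `L` and
`p`). -/
noncomputable def discriminantCover : Set (ℙ ℂ (Fin 3 → ℂ) × LineP4) :=
  {z | z.1 ∈ discriminantCurve l₁ l₂ l₃ g ∧ ∀ x : ℙ ℂ (Fin 5 → ℂ), x.submodule ≤ z.2.1 →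
    (x, z.1) ∈ blowUpL (hypersurface (threefoldEq l₁ l₂ l₃ g))}

/-- The part `C̃` of the discriminant double cover lying over the cubic `C = V(g)`. -/
noncomputable def coverOfCubic : Set (ℙ ℂ (Fin 3 → ℂ) × LineP4) :=
  {z | z ∈ discriminantCover l₁ l₂ l₃ g ∧ z.1 ∈ hypersurface g}

/-- The variety `C̃`, a subvariety of `ℙ² × G(2, 5)`. -/
noncomputable def coverOfCubicCoords :
    HomCoords (coverOfCubic l₁ l₂ l₃ g) (Fin 3 ⊕ Fin 5 × Fin 5) (ℤ × ℤ) :=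
  ((HomCoords.projSpace 3).prod grassmannian).restrict (coverOfCubic l₁ l₂ l₃ g)

/-- The plane curve `C = V(g)` as a variety. -/
noncomputable def cubicCoords : HomCoords (hypersurface g) (Fin 3) ℤ :=
  (HomCoords.projSpace 3).restrict (hypersurface g)

/-- The restriction `π : C̃ → C` of the discriminant double cover. -/
noncomputable def coverMap (z : coverOfCubic l₁ l₂ l₃ g) : hypersurface g := ⟨z.1.1, z.2.2⟩

end ProjectionFromLine

/-! Over a point `[a]` of the cubic `C`, the fibre of the conic fibration is the conic
`l₁ x₃² + l₂ x₄² + 2 l₃ x₃ x₄ = 0` in the plane spanned by `L` and `(a, 0, 0)`, with coefficients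
evaluated at `a`. If the threefold is smooth, this quadratic form is nonzero, so the fibre consists
of lines through `(a, 0, 0)`, one for each linear factor of the form. The linear factors correspond
to the square roots `y` of `l₁ l₂ - l₃²` at `a`: the factor vanishing at `(u, v)` belongs to the `y`
for which the symmetric matrix `(l₁, l₃; l₃, l₂)` maps `(u, v)` to `i y (v, -u)`. Both passages
between `(u, v)` and `y` are locally given by polynomials, so `C̃` is isomorphic to the curve
`g = 0, y² = l₁ l₂ - l₃²` in `ℙ³`.

A regular function on that curve is locally a quotient of polynomials, and on averaging over `± y`
its denominator can be taken free of `y`. This writes it as `A + B y`. Smoothness of the threefold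
also makes the conic `Q` transversal to `C`, so `l₁ l₂ - l₃²` is nonzero on a dense open subset of
`C`; there `y ≠ -y`, hence `A` and `B` are unique, and the local expressions glue. -/

/-! ### Weighted homogeneous polynomials -/

section WeightedHomogeneous

variable {σ τ M N R K : Type*} [AddCommMonoid M] [AddCommMonoid N] [CommSemiring R] [Field K]

theorem weightedHomogeneous_induction {w : σ → M} {Q : MvPolynomial σ R → M → Prop}
    (zero : ∀ m, Q 0 m) (const : ∀ c, Q (C c) 0) (var : ∀ i, Q (X i) (w i))
    (add : ∀ p q m, Q p m → Q q m → Q (p + q) m)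
    (mul : ∀ p q m n, Q p m → Q q n → Q (p * q) (m + n))
    {p : MvPolynomial σ R} {m : M} (hp : IsWeightedHomogeneous w p m) : Q p m := by
  have pow : ∀ i (k : ℕ), Q (X i ^ k) (k • w i) := by
    intro i k
    induction k with
    | zero => simpa using const 1
    | succ k ih => rw [pow_succ, succ_nsmul]; exact mul _ _ _ _ ih (var i)
  have mon : ∀ (d : σ →₀ ℕ) (c : R), Q (monomial d c) (Finsupp.weight w d) := by
    intro d
    induction d using Finsupp.induction_linear with
    | zero => intro c; simpa using const c
    | add f g hf hg =>
      intro c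
      have := mul _ _ _ _ (hf c) (hg 1)
      rwa [monomial_mul, mul_one, ← map_add] at this
    | single i k =>
      intro c
      have := mul _ _ _ _ (const c) (pow i k)
      rwa [C_mul_X_pow_eq_monomial, zero_add, ← Finsupp.weight_single] at this
  induction hp using IsWeightedHomogeneous.induction_on with
  | zero => exact zero m
  | add p q _ _ h h' => exact add _ _ _ h h'
  | monomial d r hr => exact hr ▸ mon d r

theorem isWeightedHomogeneous_aeval {w : σ → M} {w' : τ → N} (ψ : M →+ N)
    {P : σ → MvPolynomial τ R} (hP : ∀ i, IsWeightedHomogeneous w' (P i) (ψ (w i)))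
    {p : MvPolynomial σ R} {m : M} (hp : IsWeightedHomogeneous w p m) :
    IsWeightedHomogeneous w' (aeval P p) (ψ m) := by
  refine weightedHomogeneous_induction (w := w)
    (Q := fun p m => IsWeightedHomogeneous w' (aeval P p) (ψ m)) (fun m => ?_) (fun c => ?_)
    (fun i => ?_) (fun p q m hp hq => ?_) (fun p q m n hp hq => ?_) hp
  · simpa using isWeightedHomogeneous_zero _ _ _
  · simpa using isWeightedHomogeneous_C w' c
  · simpa using hP i
  · simpa using hp.add hq
  · simpa using hp.mul hq

theorem isWeightedHomogeneous_rename {w : σ → M} {w' : τ → N} (ψ : M →+ N) {f : σ → τ}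
    (hf : ∀ i, w' (f i) = ψ (w i)) {p : MvPolynomial σ R} {m : M}
    (hp : IsWeightedHomogeneous w p m) : IsWeightedHomogeneous w' (rename f p) (ψ m) := by
  rw [rename_eq_aeval]
  exact isWeightedHomogeneous_aeval ψ (fun i => hf i ▸ isWeightedHomogeneous_X R w' (f i)) hp

theorem isWeightedHomogeneous_rename_of_isHomogeneous {w : τ → M} {m : M} {f : σ → τ}
    (hf : ∀ i, w (f i) = m) {p : MvPolynomial σ R} {n : ℕ} (hp : p.IsHomogeneous n) :
    IsWeightedHomogeneous w (rename f p) (n • m) :=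
  isWeightedHomogeneous_rename (multiplesHom M m) (w := 1) (by simpa using hf) hp

theorem isWeightedHomogeneous_of_isHomogeneous {w : σ → M} {m : M} (hw : ∀ i, w i = m)
    {p : MvPolynomial σ R} {n : ℕ} (hp : p.IsHomogeneous n) :
    IsWeightedHomogeneous w p (n • m) := by
  simpa using isWeightedHomogeneous_rename_of_isHomogeneous (f := id) hw hp

theorem isWeightedHomogeneous_of_weight_zero (p : MvPolynomial σ R) :
    IsWeightedHomogeneous (fun _ : σ => (0 : M)) p 0 := by
  intro d _
  simp [Finsupp.weight_apply, Finsupp.sum]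

theorem eval_torus_smul {w : σ → M} {p : MvPolynomial σ R} {m : M}
    (hp : IsWeightedHomogeneous w p m) (c : Multiplicative M →* R) (x : σ → R) :
    eval (fun i => c (Multiplicative.ofAdd (w i)) * x i) p =
      c (Multiplicative.ofAdd m) * eval x p := by
  refine weightedHomogeneous_induction (w := w)
    (Q := fun p m => eval (fun i => c (Multiplicative.ofAdd (w i)) * x i) p =
      c (Multiplicative.ofAdd m) * eval x p) (by simp) (by simp) (by simp)
    (fun p q m hp hq => ?_) (fun p q m n hp hq => ?_) hp
  · simp only [map_add, hp, hq, mul_add]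
  · simp only [map_mul, hp, hq, ofAdd_add]
    ring

theorem eval_smul_of_isHomogeneous {p : MvPolynomial σ R} {n : ℕ} (hp : p.IsHomogeneous n)
    (c : R) (x : σ → R) : eval (c • x) p = c ^ n * eval x p := by
  simpa [Pi.smul_def, powersHom_apply] using eval_torus_smul hp (powersHom R c) x

theorem exists_clear_denominators {w : σ → M} {w' : τ → N} {p : MvPolynomial σ K} {m : M}
    (hp : IsWeightedHomogeneous w p m) (ψ : M →+ N) {D : MvPolynomial τ K} {k : N}
    (hD : IsWeightedHomogeneous w' D k) {P : σ → MvPolynomial τ K}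
    (hP : ∀ i, IsWeightedHomogeneous w' (P i) (ψ (w i) + k)) :
    ∃ (n : ℕ) (p' : MvPolynomial τ K), IsWeightedHomogeneous w' p' (ψ m + n • k) ∧
      ∀ x, eval x D ≠ 0 →
        eval x p' = eval x D ^ n * eval (fun i => eval x (P i) / eval x D) p := by
  refine weightedHomogeneous_induction (w := w)
    (Q := fun p m => ∃ (n : ℕ) (p' : MvPolynomial τ K),
      IsWeightedHomogeneous w' p' (ψ m + n • k) ∧ ∀ x, eval x D ≠ 0 →
        eval x p' = eval x D ^ n * eval (fun i => eval x (P i) / eval x D) p)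
    (fun m => ⟨0, 0, isWeightedHomogeneous_zero _ _ _, by simp⟩)
    (fun c => ⟨0, C c, by simpa using isWeightedHomogeneous_C w' c, by simp⟩)
    (fun i => ⟨1, P i, by simpa using hP i, fun x hx => by simp [mul_div_cancel₀ _ hx]⟩)
    ?_ ?_ hp
  · rintro p q m ⟨n, p', hp', h⟩ ⟨n', q', hq', h'⟩
    refine ⟨n + n', p' * D ^ n' + q' * D ^ n, .add ?_ ?_, fun x hx => ?_⟩
    · simpa only [add_smul, add_assoc] using hp'.mul (hD.pow n')
    · simpa only [add_smul, add_assoc, add_comm (n' • k)] using hq'.mul (hD.pow n)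
    · simp only [map_add, map_mul, map_pow, h x hx, h' x hx]
      ring
  · rintro p q m l ⟨n, p', hp', h⟩ ⟨n', q', hq', h'⟩
    refine ⟨n + n', p' * q', ?_, fun x hx => ?_⟩
    · rw [map_add, add_smul, add_add_add_comm]
      exact hp'.mul hq'
    · simp only [map_mul, h x hx, h' x hx]
      ring

end WeightedHomogeneous

/-! ### Varieties in homogeneous coordinates -/

namespace HomCoords

variable {Y σ M Y' σ' M' Y'' σ'' M'' : Type} [AddCommGroup M] [AddCommGroup M'] [AddCommGroup M'']
  {H : HomCoords Y σ M} {H' : HomCoords Y' σ' M'} {H'' : HomCoords Y'' σ'' M''}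

/-- The basic open set `D(B)`: the points none of whose coordinate vectors is a zero of `B`. -/
def basicOpen (H : HomCoords Y σ M) (B : MvPolynomial σ ℂ) : Set Y :=
  {y | ∀ x ∈ H.cone y, eval x B ≠ 0}

/-- Every point has coordinates, and any two coordinate vectors of a point differ by the action of
the grading torus. This is what makes the vanishing of a homogeneous polynomial at a point
meaningful. -/
structure WellFormed (H : HomCoords Y σ M) : Prop where
  nonempty : ∀ y, (H.cone y).Nonempty
  torus : ∀ y, ∀ x ∈ H.cone y, ∀ x' ∈ H.cone y, ∃ c : Multiplicative M →* ℂˣ,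
    x' = fun i => c (Multiplicative.ofAdd (H.wt i)) * x i

theorem WellFormed.mem_basicOpen_iff (hH : H.WellFormed) {y : Y} {x : σ → ℂ} (hx : x ∈ H.cone y)
    {B : MvPolynomial σ ℂ} {k : M} (hB : IsWeightedHomogeneous H.wt B k) :
    y ∈ H.basicOpen B ↔ eval x B ≠ 0 := by
  refine ⟨fun h => h x hx, fun h x' hx' => ?_⟩
  obtain ⟨c, rfl⟩ := hH.torus y x hx x' hx'
  have := eval_torus_smul hB ((Units.coeHom ℂ).comp c) x
  simp only [MonoidHom.comp_apply, Units.coeHom_apply] at this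
  rw [this]
  exact mul_ne_zero (Units.ne_zero _) h

theorem WellFormed.restrict (hH : H.WellFormed) (S : Set Y) : (H.restrict S).WellFormed :=
  ⟨fun y => hH.nonempty y.1, fun y => hH.torus y.1⟩

theorem WellFormed.prod (hH : H.WellFormed) (hH' : H'.WellFormed) : (H.prod H').WellFormed := by
  refine ⟨fun y => ?_, fun y x hx x' hx' => ?_⟩
  · obtain ⟨a, ha⟩ := hH.nonempty y.1
    obtain ⟨b, hb⟩ := hH'.nonempty y.2
    exact ⟨Sum.elim a b, ha, hb⟩
  · obtain ⟨c, hc⟩ := hH.torus y.1 _ hx.1 _ hx'.1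
    obtain ⟨c', hc'⟩ := hH'.torus y.2 _ hx.2 _ hx'.2
    refine ⟨(c.comp (AddMonoidHom.fst M M').toMultiplicative) *
      (c'.comp (AddMonoidHom.snd M M').toMultiplicative), funext fun i => ?_⟩
    cases i with
    | inl i => simpa [HomCoords.prod] using congrFun hc i
    | inr j => simpa [HomCoords.prod] using congrFun hc' j

theorem wellFormed_of_smul {H : HomCoords Y σ ℤ} (hw : ∀ i, H.wt i = 1)
    (hne : ∀ y, (H.cone y).Nonempty)
    (h : ∀ y, ∀ x ∈ H.cone y, ∀ x' ∈ H.cone y, ∃ c : ℂ, c ≠ 0 ∧ x' = c • x) : H.WellFormed := by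
  refine ⟨hne, fun y x hx x' hx' => ?_⟩
  obtain ⟨c, hc, rfl⟩ := h y x hx x' hx'
  refine ⟨zpowersHom ℂˣ (Units.mk0 c hc), funext fun i => ?_⟩
  simp [hw, zpowersHom_apply]

theorem isOpen_basicOpen {B : MvPolynomial σ ℂ} {k : M} (hB : IsWeightedHomogeneous H.wt B k) :
    IsOpen[H.zariski] (H.basicOpen B) :=
  TopologicalSpace.isOpen_generateFrom_of_mem ⟨k, B, hB, rfl⟩

theorem WellFormed.isClosed_vanishing (hH : H.WellFormed) {B : MvPolynomial σ ℂ} {k : M}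
    (hB : IsWeightedHomogeneous H.wt B k) :
    IsClosed[H.zariski] {y | ∀ x ∈ H.cone y, eval x B = 0} := by
  let _ := H.zariski
  rw [← isOpen_compl_iff]
  convert isOpen_basicOpen hB using 1
  ext y
  obtain ⟨x, hx⟩ := hH.nonempty y
  rw [hH.mem_basicOpen_iff hx hB]
  refine ⟨fun h hxB => h fun x' hx' => ?_, fun h h0 => h (h0 x hx)⟩
  by_contra hx'B
  exact (hH.mem_basicOpen_iff hx' hB).2 hx'B x hx hxB

theorem isTopologicalBasis_basicOpen (H : HomCoords Y σ M) :
    @TopologicalSpace.IsTopologicalBasis Y H.zariski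
      {D | ∃ (k : M) (B : MvPolynomial σ ℂ), IsWeightedHomogeneous H.wt B k ∧
        D = H.basicOpen B} := by
  let _ := H.zariski
  refine ⟨?_, Set.eq_univ_of_univ_subset fun y _ => ?_, rfl⟩
  · rintro _ ⟨k, B, hB, rfl⟩ _ ⟨k', B', hB', rfl⟩ y hy
    refine ⟨_, ⟨k + k', B * B', hB.mul hB', rfl⟩, fun x hx => ?_, fun y' hy' => ?_⟩
    · simpa using ⟨hy.1 x hx, hy.2 x hx⟩
    · have hBB' : ∀ x ∈ H.cone y', eval x B ≠ 0 ∧ eval x B' ≠ 0 := fun x hx => by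
        simpa using hy' x hx
      exact ⟨fun x hx => (hBB' x hx).1, fun x hx => (hBB' x hx).2⟩
  · exact ⟨_, ⟨0, 1, isWeightedHomogeneous_one _ _, rfl⟩, by simp [basicOpen]⟩

theorem sections_torus_smul {d : M} {V : Set Y} {s : H.ConeOver V → ℂ} (hs : s ∈ H.sections d V)
    (y : V) (x x' : H.cone y.1) {c : Multiplicative M →* ℂˣ}
    (hc : x'.1 = fun i => c (Multiplicative.ofAdd (H.wt i)) * x.1 i) :
    s ⟨y, x'⟩ = c (Multiplicative.ofAdd d) * s ⟨y, x⟩ := by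
  obtain ⟨k, A, B, hA, hB, hB0, hAB⟩ := hs y
  have hA' := eval_torus_smul hA ((Units.coeHom ℂ).comp c) x.1
  have hB' := eval_torus_smul hB ((Units.coeHom ℂ).comp c) x.1
  simp only [MonoidHom.comp_apply, Units.coeHom_apply, ← hc] at hA' hB'
  rw [hAB ⟨y, x'⟩ (hB0 _ x'.2), hAB ⟨y, x⟩ (hB0 _ x.2), hA', hB', ofAdd_add, map_mul,
    Units.val_mul]
  have hBx := hB0 _ x.2
  have hck := Units.ne_zero (c (Multiplicative.ofAdd k))
  field_simp

theorem mul_mem_sections {d e : M} {V : Set Y} {s t : H.ConeOver V → ℂ}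
    (hs : s ∈ H.sections d V) (ht : t ∈ H.sections e V) : s * t ∈ H.sections (d + e) V := by
  intro y
  obtain ⟨k, A, B, hA, hB, hB0, hAB⟩ := hs y
  obtain ⟨k', A', B', hA', hB', hB0', hAB'⟩ := ht y
  refine ⟨k + k', A * A', B * B', ?_, hB.mul hB', fun x hx => ?_, fun z hz => ?_⟩
  · rw [add_add_add_comm]
    exact hA.mul hA'
  · simpa using ⟨hB0 x hx, hB0' x hx⟩
  · rw [map_mul] at hz
    rw [Pi.mul_apply, hAB z (left_ne_zero_of_mul hz), hAB' z (right_ne_zero_of_mul hz), map_mul,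
      map_mul, div_mul_div_comm]

theorem regular_mul_mem_sections {d : M} {V : Set Y} {f : V → ℂ} (hf : f ∈ H.regular V)
    {s : H.ConeOver V → ℂ} (hs : s ∈ H.sections d V) :
    (fun z : H.ConeOver V => f z.1 * s z) ∈ H.sections d V := by
  rw [← zero_add d]
  exact mul_mem_sections hf hs

/-- A map which locally is given by quotients of homogeneous polynomials with a common
denominator; the degrees of the coordinates are matched by a homomorphism of the grading groups. -/
def LocallyRational (H : HomCoords Y σ M) (H' : HomCoords Y' σ' M') (f : Y → Y') : Prop :=
  ∃ ψ : M' →+ M, ∀ y₀, ∃ (k : M) (D : MvPolynomial σ ℂ) (P : σ' → MvPolynomial σ ℂ),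
    IsWeightedHomogeneous H.wt D k ∧ (∀ j, IsWeightedHomogeneous H.wt (P j) (ψ (H'.wt j) + k)) ∧
    y₀ ∈ H.basicOpen D ∧
    ∀ y, ∀ x ∈ H.cone y, eval x D ≠ 0 → (fun j => eval x (P j) / eval x D) ∈ H'.cone (f y)

namespace LocallyRational

variable {f : Y → Y'}

theorem restrict (hf : LocallyRational H H' f) {S : Set Y} {S' : Set Y'}
    (h : Set.MapsTo f S S') : LocallyRational (H.restrict S) (H'.restrict S') (h.restrict f S S') :=
  hf.imp fun _ hψ y₀ => by
    obtain ⟨k, D, P, hD, hP, hD₀, hfD⟩ := hψ y₀.1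
    exact ⟨k, D, P, hD, hP, hD₀, fun y => hfD y.1⟩

theorem continuous (hH : H.WellFormed) (hH' : H'.WellFormed) (hf : LocallyRational H H' f) :
    Continuous[H.zariski, H'.zariski] f := by
  obtain ⟨ψ, hψ⟩ := hf
  let _ := H.zariski
  refine continuous_generateFrom_iff.2 ?_
  rintro _ ⟨m, B, hB, rfl⟩
  refine isOpen_iff_forall_mem_open.2 fun y₀ hy₀ => ?_
  obtain ⟨k, D, P, hD, hP, hD₀, hfD⟩ := hψ y₀
  obtain ⟨n, B', hB', hBB'⟩ := exists_clear_denominators hB ψ hD hP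
  refine ⟨_, fun y hy => ?_, isOpen_basicOpen (hD.mul hB'), fun x hx => ?_⟩
  · obtain ⟨x, hx⟩ := hH.nonempty y
    have hDB := hy x hx
    rw [map_mul] at hDB
    have hDx := left_ne_zero_of_mul hDB
    have hBx := right_ne_zero_of_mul hDB
    rw [hBB' x hDx] at hBx
    exact (hH'.mem_basicOpen_iff (hfD y x hx hDx) hB).2 (right_ne_zero_of_mul hBx)
  · have hDx := hD₀ x hx
    rw [map_mul, hBB' x hDx]
    exact mul_ne_zero hDx (mul_ne_zero (pow_ne_zero _ hDx) (hy₀ _ (hfD y₀ x hx hDx)))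

theorem regular_comp (hf : LocallyRational H H' f) {V : Set Y'} {h : V → ℂ}
    (hh : h ∈ H'.regular V) :
    (fun y : f ⁻¹' V => h ⟨f y.1, y.2⟩) ∈ H.regular (f ⁻¹' V) := by
  obtain ⟨ψ, hψ⟩ := hf
  intro y₀
  obtain ⟨k, D, P, hD, hP, hD₀, hfD⟩ := hψ y₀.1
  obtain ⟨m, A, B, hA, hB, hB₀, hAB⟩ := hh ⟨f y₀.1, y₀.2⟩
  obtain ⟨n, A', hA', hAA'⟩ := exists_clear_denominators hA ψ hD hP
  obtain ⟨n', B', hB', hBB'⟩ := exists_clear_denominators hB ψ hD hP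
  refine ⟨ψ m + n' • k + n • k + k, A' * D ^ n' * D, B' * D ^ n * D, ?_,
    (hB'.mul (hD.pow n)).mul hD, fun x hx => ?_, ?_⟩
  · rw [show ψ m + n' • k + n • k + k + 0 = ψ (m + 0) + n • k + n' • k + k by
      rw [add_zero, add_zero]
      abel]
    exact (hA'.mul (hD.pow n')).mul hD
  · have hDx := hD₀ x hx
    simp only [map_mul, map_pow, hBB' x hDx]
    exact mul_ne_zero (mul_ne_zero (mul_ne_zero (pow_ne_zero _ hDx)
      (hB₀ _ (hfD _ x hx hDx))) (pow_ne_zero _ hDx)) hDx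
  · rintro ⟨y, x, hx⟩ hne
    simp only [map_mul, map_pow] at hne ⊢
    have hDx := right_ne_zero_of_mul hne
    have hBx : eval (fun i => eval x (P i) / eval x D) B ≠ 0 := fun hBx => hne (by
      rw [hBB' x hDx, hBx]
      ring)
    have hhy := hAB ⟨⟨f y.1, y.2⟩, ⟨_, hfD y.1 x hx hDx⟩⟩ hBx
    simp only at hhy
    rw [hhy, hAA' x hDx, hBB' x hDx]
    field_simp

theorem isMorphism (hH : H.WellFormed) (hH' : H'.WellFormed) (hf : LocallyRational H H' f) :
    IsMorphism H H' f :=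
  ⟨hf.continuous hH hH', fun _ _ _ hh => hf.regular_comp hh⟩

end LocallyRational

theorem IsMorphism.comp {f : Y → Y'} {f' : Y' → Y''} (hf' : IsMorphism H' H'' f')
    (hf : IsMorphism H H' f) : IsMorphism H H'' (f' ∘ f) := by
  refine ⟨@Continuous.comp _ _ _ H.zariski H'.zariski H''.zariski _ _ hf'.1 hf.1,
    fun V hV h hh => ?_⟩
  let _ := H'.zariski
  let _ := H''.zariski
  exact hf.2 _ (hV.preimage hf'.1) _ (hf'.2 V hV h hh)

theorem affineSpace_wellFormed (n : ℕ) : (affineSpace n).WellFormed := by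
  refine ⟨fun y => ⟨y, rfl⟩, fun y x hx x' hx' => ⟨1, ?_⟩⟩
  rw [show x = y from hx, show x' = y from hx']
  simp

theorem isClosed_affineSpace_vanishing {n : ℕ} (P : MvPolynomial (Fin n) ℂ) :
    IsClosed[(affineSpace n).zariski] {x | eval x P = 0} := by
  convert (affineSpace_wellFormed n).isClosed_vanishing (B := P) (k := 0)
    (isWeightedHomogeneous_of_weight_zero P) using 1
  ext x
  exact ⟨fun h y hy => by rwa [show y = x from hy], fun h => h x rfl⟩

theorem IsAffine.of_isMorphism_id {K : HomCoords Y σ' M'} (h : IsAffine H)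
    (h₁ : IsMorphism K H id) (h₂ : IsMorphism H K id) : IsAffine K := by
  obtain ⟨n, Z, hZ, e, he, he'⟩ := h
  exact ⟨n, Z, hZ, e, he.comp h₁, h₂.comp he'⟩

section ProjSpace

variable {n : ℕ} {p q : ℙ ℂ (Fin n → ℂ)} {a b : Fin n → ℂ}

theorem mk_mem_projSpace_cone (ha : a ≠ 0) :
    a ∈ (projSpace n).cone (Projectivization.mk ℂ a ha) :=
  ⟨ha, by rw [Projectivization.submodule_mk]; exact Submodule.mem_span_singleton_self _⟩

theorem mem_submodule_iff_of_mem_cone (ha : a ∈ (projSpace n).cone p) :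
    b ∈ p.submodule ↔ ∃ c : ℂ, c • a = b := by
  obtain ⟨ha0, hap⟩ := ha
  rw [Projectivization.submodule_eq] at hap ⊢
  obtain ⟨t, rfl⟩ := Submodule.mem_span_singleton.1 hap
  rw [← Submodule.mem_span_singleton, Submodule.span_singleton_smul_eq]
  exact (isUnit_iff_ne_zero.2 fun ht => ha0 (by rw [ht, zero_smul]))

theorem mem_projSpace_cone_iff (ha : a ∈ (projSpace n).cone p) :
    b ∈ (projSpace n).cone p ↔ ∃ c : ℂ, c ≠ 0 ∧ b = c • a := by
  refine ⟨fun hb => ?_, ?_⟩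
  · obtain ⟨c, rfl⟩ := (mem_submodule_iff_of_mem_cone ha).1 hb.2
    exact ⟨c, fun hc => hb.1 (by rw [hc, zero_smul]), rfl⟩
  · rintro ⟨c, hc, rfl⟩
    exact ⟨smul_ne_zero hc ha.1, p.submodule.smul_mem c ha.2⟩

theorem smul_mem_projSpace_cone (ha : a ∈ (projSpace n).cone p) {c : ℂ} (hc : c ≠ 0) :
    c • a ∈ (projSpace n).cone p :=
  (mem_projSpace_cone_iff ha).2 ⟨c, hc, rfl⟩

theorem eq_of_mem_projSpace_cone (hp : a ∈ (projSpace n).cone p) (hq : a ∈ (projSpace n).cone q) :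
    p = q := by
  refine Projectivization.submodule_injective (Submodule.ext fun b => ?_)
  rw [mem_submodule_iff_of_mem_cone hp, mem_submodule_iff_of_mem_cone hq]

theorem projSpace_wellFormed (n : ℕ) : (projSpace n).WellFormed := by
  refine wellFormed_of_smul (fun _ => rfl) (fun p => ?_)
    fun p x hx x' hx' => (mem_projSpace_cone_iff hx).1 hx'
  rw [← p.mk_rep]
  exact ⟨_, mk_mem_projSpace_cone p.rep_nonzero⟩

end ProjSpace

theorem grassmannian_cone_nonempty (m : LineP4) : (grassmannian.cone m).Nonempty := by
  let b := Module.finBasisOfFinrankEq ℂ m.1 m.2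
  have hrange : ((↑) : m.1 → Fin 5 → ℂ) '' Set.range b =
      {(b 0 : Fin 5 → ℂ), (b 1 : Fin 5 → ℂ)} := by
    ext x
    simp [Fin.exists_fin_two, eq_comm]
  refine ⟨_, b 0, b 1, ?_, ?_, rfl⟩
  · have hli := b.linearIndependent.map' m.1.subtype m.1.ker_subtype
    rwa [show m.1.subtype ∘ b = ![(b 0 : Fin 5 → ℂ), b 1] from
      funext fun i => by fin_cases i <;> rfl] at hli
  · rw [← hrange, ← Submodule.coe_subtype, ← Submodule.map_span, b.span_eq, Submodule.map_top,
      Submodule.range_subtype]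

theorem grassmannian_cone_smul {m : LineP4} {ω ω' : Fin 5 × Fin 5 → ℂ}
    (hω : ω ∈ grassmannian.cone m) (hω' : ω' ∈ grassmannian.cone m) :
    ∃ c : ℂ, c ≠ 0 ∧ ω' = c • ω := by
  obtain ⟨v, w, -, hs, rfl⟩ := hω
  obtain ⟨v', w', hli', hs', rfl⟩ := hω'
  have hv : v' ∈ Submodule.span ℂ {v, w} := hs.trans hs'.symm ▸ Submodule.subset_span (by simp)
  have hw : w' ∈ Submodule.span ℂ {v, w} := hs.trans hs'.symm ▸ Submodule.subset_span (by simp)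
  obtain ⟨a, b, rfl⟩ := Submodule.mem_span_pair.1 hv
  obtain ⟨c, d, rfl⟩ := Submodule.mem_span_pair.1 hw
  refine ⟨a * d - b * c, fun hdet => ?_, ?_⟩
  · rw [LinearIndependent.pair_iff] at hli'
    obtain ⟨-, hb⟩ := hli' d (-b) (by linear_combination (norm := module) hdet • v)
    obtain ⟨-, ha⟩ := hli' c (-a) (by linear_combination (norm := module) -hdet • w)
    have h10 := hli' 1 0 (by simp [neg_eq_zero.1 ha, neg_eq_zero.1 hb])
    exact one_ne_zero h10.1
  · funext ij
    simp only [Pi.add_apply, Pi.smul_apply, smul_eq_mul]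
    ring

theorem grassmannian_wellFormed : grassmannian.WellFormed :=
  wellFormed_of_smul (fun _ => rfl) grassmannian_cone_nonempty
    fun _ _ hω _ hω' => grassmannian_cone_smul hω hω'

end HomCoords

theorem mem_hypersurface_iff {n m : ℕ} {P : MvPolynomial (Fin n) ℂ} (hP : P.IsHomogeneous m)
    {p : ℙ ℂ (Fin n → ℂ)} {x : Fin n → ℂ} (hx : x ∈ (HomCoords.projSpace n).cone p) :
    p ∈ hypersurface P ↔ eval x P = 0 := by
  refine ⟨fun h => h x hx.2, fun h y hy => ?_⟩
  obtain ⟨c, rfl⟩ := (HomCoords.mem_submodule_iff_of_mem_cone hx).1 hy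
  rw [eval_smul_of_isHomogeneous hP, h, mul_zero]

/-! ### Affine charts of projective varieties -/

namespace HomCoords

variable {Y σ : Type} {H : HomCoords Y σ ℤ} {I : Set (MvPolynomial σ ℂ)}

/-- `H` presents `Y` as the closed subvariety of a projective space cut out by the equations `I`:
the cones are the orbits of scaling on the nonzero common zeros of `I`. -/
structure IsProjective (H : HomCoords Y σ ℤ) (I : Set (MvPolynomial σ ℂ)) : Prop where
  wt_eq_one : ∀ i, H.wt i = 1
  cone_nonempty : ∀ y, (H.cone y).Nonempty
  mem_cone_iff : ∀ {y w w'}, w ∈ H.cone y → (w' ∈ H.cone y ↔ ∃ c : ℂ, c ≠ 0 ∧ w' = c • w)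
  eq_of_mem_cone : ∀ {y y' w}, w ∈ H.cone y → w ∈ H.cone y' → y = y'
  exists_mem_cone_iff : ∀ {w}, (∃ y, w ∈ H.cone y) ↔ w ≠ 0 ∧ ∀ P ∈ I, eval w P = 0

/-- The affine equations of the chart `x_i ≠ 0`, normalised by `x_i = 1`, with the coordinates
numbered by `e`. -/
def affineChart {n : ℕ} (I : Set (MvPolynomial σ ℂ)) (e : σ ≃ Fin n) (i : σ) : Set (Fin n → ℂ) :=
  {b | b (e i) = 1 ∧ ∀ P ∈ I, eval (b ∘ e) P = 0}

theorem isClosed_affineChart {n : ℕ} (I : Set (MvPolynomial σ ℂ)) (e : σ ≃ Fin n) (i : σ) :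
    IsClosed[(affineSpace n).zariski] (affineChart I e i) := by
  let _ := (affineSpace n).zariski
  have h : affineChart I e i = {b | eval b (X (e i) - 1) = 0} ∩
      ⋂ P ∈ I, {b | eval b (rename e P) = 0} := by
    ext b
    simp [affineChart, sub_eq_zero, eval_rename]
  rw [h]
  exact (isClosed_affineSpace_vanishing _).inter
    (isClosed_biInter fun P _ => isClosed_affineSpace_vanishing _)

namespace IsProjective

theorem wellFormed (hH : H.IsProjective I) : H.WellFormed :=
  wellFormed_of_smul hH.wt_eq_one hH.cone_nonempty fun _ _ hx _ hx' => (hH.mem_cone_iff hx).1 hx'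

theorem isWeightedHomogeneous_X (hH : H.IsProjective I) (i : σ) :
    IsWeightedHomogeneous H.wt (X i : MvPolynomial σ ℂ) 1 := by
  simpa only [hH.wt_eq_one] using MvPolynomial.isWeightedHomogeneous_X ℂ H.wt i

theorem mem_basicOpen_X_iff (hH : H.IsProjective I) {i : σ} {y : Y} {x : σ → ℂ}
    (hx : x ∈ H.cone y) : y ∈ H.basicOpen (X i) ↔ x i ≠ 0 := by
  rw [hH.wellFormed.mem_basicOpen_iff hx (hH.isWeightedHomogeneous_X i), eval_X]

variable {n : ℕ} {e : σ ≃ Fin n} {i : σ} {y : Y} {x : σ → ℂ} {b : Fin n → ℂ}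

theorem exists_point_of_mem_affineChart (hH : H.IsProjective I) (hb : b ∈ affineChart I e i) :
    ∃ y, b ∘ e ∈ H.cone y := by
  refine hH.exists_mem_cone_iff.2 ⟨fun h => ?_, hb.2⟩
  have hbi : b (e i) = 0 := congrFun h i
  exact zero_ne_one (hbi.symm.trans hb.1)

theorem div_mem_cone (hH : H.IsProjective I) (hx : x ∈ H.cone y) (hxi : x i ≠ 0) :
    (fun j => x j / x i) ∈ H.cone y := by
  refine (hH.mem_cone_iff hx).2 ⟨(x i)⁻¹, inv_ne_zero hxi, funext fun j => ?_⟩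
  rw [Pi.smul_apply, smul_eq_mul, div_eq_inv_mul]

theorem div_mem_affineChart (hH : H.IsProjective I) (hx : x ∈ H.cone y) (hxi : x i ≠ 0) :
    (fun j => x (e.symm j) / x i) ∈ affineChart I e i := by
  refine ⟨by simp [hxi], ?_⟩
  simpa [Function.comp_def] using (hH.exists_mem_cone_iff.1 ⟨y, hH.div_mem_cone hx hxi⟩).2

theorem div_eq_of_mem_affineChart (hH : H.IsProjective I) (hb : b ∈ affineChart I e i)
    (hby : b ∘ e ∈ H.cone y) (hx : x ∈ H.cone y) : (fun j => x (e.symm j) / x i) = b := by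
  obtain ⟨c, hc, rfl⟩ := (hH.mem_cone_iff hby).1 hx
  funext j
  simp [hb.1, hc]

theorem isAffine_basicOpen_X [Finite σ] (hH : H.IsProjective I) (i : σ) :
    IsAffine (H.restrict (H.basicOpen (X i))) := by
  obtain ⟨n, ⟨e⟩⟩ := Finite.exists_equiv_fin σ
  let Z := affineChart I e i
  choose p hp using fun b : Z => hH.exists_point_of_mem_affineChart b.2
  have hpi : ∀ b : Z, p b ∈ H.basicOpen (X i) := fun b =>
    (hH.mem_basicOpen_X_iff (hp b)).2 (b.2.1.trans_ne one_ne_zero)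
  have hbij : Function.Bijective fun b : Z => (⟨p b, hpi b⟩ : H.basicOpen (X i)) := by
    refine ⟨fun b b' hbb' => Subtype.ext ?_, fun y => ?_⟩
    · have hpp : p b = p b' := congrArg Subtype.val hbb'
      have hb' : b'.1 ∘ e ∈ H.cone (p b) := hpp ▸ hp b'
      rw [← hH.div_eq_of_mem_affineChart b.2 (hp b) (hp b),
        hH.div_eq_of_mem_affineChart b'.2 hb' (hp b)]
    · obtain ⟨x, hx⟩ := hH.cone_nonempty y.1
      have hxi := (hH.mem_basicOpen_X_iff hx).1 y.2
      refine ⟨⟨_, hH.div_mem_affineChart hx hxi⟩, Subtype.ext (hH.eq_of_mem_cone (hp _) ?_)⟩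
      simpa [Function.comp_def] using hH.div_mem_cone hx hxi
  let E := Equiv.ofBijective _ hbij
  have hE : ∀ y, (E.symm y).1 ∘ e ∈ H.cone y.1 := fun y => by
    have hy : p (E.symm y) = y.1 := congrArg Subtype.val (E.apply_symm_apply y)
    exact hy ▸ hp (E.symm y)
  have hH' := hH.wellFormed.restrict (H.basicOpen (X i))
  have hZ := (affineSpace_wellFormed n).restrict Z
  refine ⟨n, Z, isClosed_affineChart I e i, E.symm,
    LocallyRational.isMorphism hH' hZ ⟨0, fun y₀ => ⟨1, X i, fun j => X (e.symm j),
      hH.isWeightedHomogeneous_X i, fun j => hH.isWeightedHomogeneous_X _, y₀.2, ?_⟩⟩,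
    LocallyRational.isMorphism hZ hH' ⟨0, fun b₀ => ⟨0, 1, fun j => X (e j),
      isWeightedHomogeneous_one _ _, fun j => MvPolynomial.isWeightedHomogeneous_X ℂ _ _,
      by simp [basicOpen], ?_⟩⟩⟩
  · intro y x hx _
    simp only [eval_X]
    exact hH.div_eq_of_mem_affineChart (E.symm y).2 (hE y) hx
  · rintro b x hx -
    rw [show x = b.1 from hx]
    simp only [eval_X, map_one, div_one]
    exact hp b

end IsProjective

end HomCoords

/-! ### Quotients of polynomials in a square root -/

theorem eq_zero_of_forall_sqrt {c F T : ℂ} (hc : c ≠ 0) (h : ∀ y, y ^ 2 = c → F + y * T = 0) :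
    F = 0 ∧ T = 0 := by
  obtain ⟨y, hy⟩ := IsAlgClosed.exists_pow_nat_eq c two_pos
  have hy0 : y ≠ 0 := fun hy0 => hc (by rw [← hy, hy0, zero_pow two_ne_zero])
  have h₁ := h y hy
  have h₂ := h (-y) (by rw [neg_sq, hy])
  refine ⟨by linear_combination (h₁ + h₂) / 2, mul_left_cancel₀ hy0 ?_⟩
  linear_combination (h₁ - h₂) / 2

section Root

variable {σ M R : Type*} [AddCommGroup M] [CommRing R] {w : σ → M} {d : M} {s : MvPolynomial σ R}

theorem exists_linear_in_root (hs : IsWeightedHomogeneous w s (d + d))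
    {A : MvPolynomial (σ ⊕ Unit) R} {n : M}
    (hA : IsWeightedHomogeneous (Sum.elim w fun _ => d) A n) :
    ∃ α β : MvPolynomial σ R, IsWeightedHomogeneous w α n ∧ IsWeightedHomogeneous w β (n - d) ∧
      ∀ x y, y ^ 2 = eval x s → eval (Sum.elim x fun _ => y) A = eval x α + y * eval x β := by
  refine weightedHomogeneous_induction (w := Sum.elim w fun _ => d)
    (Q := fun A n => ∃ α β : MvPolynomial σ R, IsWeightedHomogeneous w α n ∧
      IsWeightedHomogeneous w β (n - d) ∧ ∀ x y, y ^ 2 = eval x s →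
        eval (Sum.elim x fun _ => y) A = eval x α + y * eval x β)
    (fun m => ⟨0, 0, isWeightedHomogeneous_zero _ _ _, isWeightedHomogeneous_zero _ _ _, by simp⟩)
    (fun c => ⟨C c, 0, isWeightedHomogeneous_C _ _, isWeightedHomogeneous_zero _ _ _, by simp⟩)
    ?_ ?_ ?_ hA
  · rintro (i | i)
    · exact ⟨X i, 0, isWeightedHomogeneous_X R _ i, isWeightedHomogeneous_zero _ _ _, by simp⟩
    · exact ⟨0, 1, isWeightedHomogeneous_zero _ _ _,
        by simpa using isWeightedHomogeneous_one R w, by simp⟩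
  · rintro p q m ⟨α, β, hα, hβ, h⟩ ⟨α', β', hα', hβ', h'⟩
    refine ⟨α + α', β + β', hα.add hα', hβ.add hβ', fun x y hy => ?_⟩
    simp only [map_add, h x y hy, h' x y hy]
    ring
  · rintro p q m n ⟨α, β, hα, hβ, h⟩ ⟨α', β', hα', hβ', h'⟩
    refine ⟨α * α' + β * β' * s, α * β' + β * α', (hα.mul hα').add ?_, .add ?_ ?_,
      fun x y hy => ?_⟩
    · convert (hβ.mul hβ').mul hs using 1
      abel
    · convert hα.mul hβ' using 1
      abel
    · convert hβ.mul hα' using 1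
      abel
    · simp only [map_add, map_mul, h x y hy, h' x y hy]
      linear_combination (eval x β * eval x β') * hy

/-- The coefficient of `1` in `(p + y q) (p' - y q')`, where `y = √s` has degree `d`. -/
theorem isWeightedHomogeneous_mul_conj_one (hs : IsWeightedHomogeneous w s (d + d))
    {p q p' q' : MvPolynomial σ R} {k k' : M} (hp : IsWeightedHomogeneous w p k)
    (hq : IsWeightedHomogeneous w q (k - d)) (hp' : IsWeightedHomogeneous w p' k')
    (hq' : IsWeightedHomogeneous w q' (k' - d)) :
    IsWeightedHomogeneous w (p * p' - q * q' * s) (k + k') := by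
  refine (hp.mul hp').sub ?_
  convert (hq.mul hq').mul hs using 1
  abel

/-- The coefficient of `y` in `(p + y q) (p' - y q')`, where `y` has degree `d`. -/
theorem isWeightedHomogeneous_mul_conj_root {p q p' q' : MvPolynomial σ R} {k k' : M}
    (hp : IsWeightedHomogeneous w p k) (hq : IsWeightedHomogeneous w q (k - d))
    (hp' : IsWeightedHomogeneous w p' k') (hq' : IsWeightedHomogeneous w q' (k' - d)) :
    IsWeightedHomogeneous w (q * p' - p * q') (k + k' + -d) := by
  refine .sub ?_ ?_
  · convert hq.mul hp' using 1
    abel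
  · convert hp.mul hq' using 1
    abel

/-- A quotient `f = A / B = A' / B'` of elements linear in `y = √s` has the denominator
`B(y) B'(-y) + B(-y) B'(y)`, which does not involve `y`. -/
theorem exists_rationalized_quotient (hs : IsWeightedHomogeneous w s (d + d))
    {A B A' B' : MvPolynomial (σ ⊕ Unit) R} {k k' : M}
    (hA : IsWeightedHomogeneous (Sum.elim w fun _ => d) A k)
    (hB : IsWeightedHomogeneous (Sum.elim w fun _ => d) B k)
    (hA' : IsWeightedHomogeneous (Sum.elim w fun _ => d) A' k')
    (hB' : IsWeightedHomogeneous (Sum.elim w fun _ => d) B' k') :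
    ∃ N F T : MvPolynomial σ R, IsWeightedHomogeneous w N (k + k') ∧
      IsWeightedHomogeneous w F (k + k') ∧ IsWeightedHomogeneous w T (k + k' + -d) ∧
      ∀ x y, y ^ 2 = eval x s →
        eval x N = eval (Sum.elim x fun _ => y) B * eval (Sum.elim x fun _ => -y) B' +
          eval (Sum.elim x fun _ => -y) B * eval (Sum.elim x fun _ => y) B' ∧
        ∀ f, f * eval (Sum.elim x fun _ => y) B = eval (Sum.elim x fun _ => y) A →
          f * eval (Sum.elim x fun _ => y) B' = eval (Sum.elim x fun _ => y) A' →
          f * eval x N = eval x F + y * eval x T := by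
  obtain ⟨α, β, hα, hβ, hAe⟩ := exists_linear_in_root hs hA
  obtain ⟨γ, δ, hγ, hδ, hBe⟩ := exists_linear_in_root hs hB
  obtain ⟨α', β', hα', hβ', hAe'⟩ := exists_linear_in_root hs hA'
  obtain ⟨γ', δ', hγ', hδ', hBe'⟩ := exists_linear_in_root hs hB'
  refine ⟨(γ * γ' - δ * δ' * s) + (γ * γ' - δ * δ' * s),
    (α * γ' - β * δ' * s) + (γ * α' - δ * β' * s),
    (β * γ' - α * δ') - (δ * α' - γ * β'),
    (isWeightedHomogeneous_mul_conj_one hs hγ hδ hγ' hδ').add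
      (isWeightedHomogeneous_mul_conj_one hs hγ hδ hγ' hδ'),
    (isWeightedHomogeneous_mul_conj_one hs hα hβ hγ' hδ').add
      (isWeightedHomogeneous_mul_conj_one hs hγ hδ hα' hβ'),
    (isWeightedHomogeneous_mul_conj_root hα hβ hγ' hδ').sub
      (isWeightedHomogeneous_mul_conj_root hγ hδ hα' hβ'),
    fun x y hy => ?_⟩
  have hy' : (-y) ^ 2 = eval x s := by rw [neg_sq, hy]
  simp only [hAe x y hy, hBe x y hy, hAe' x y hy, hBe' x y hy, hBe x _ hy', hBe' x _ hy',
    map_add, map_sub, map_mul]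
  refine ⟨by linear_combination (2 * eval x δ * eval x δ') * hy, fun f h h' => ?_⟩
  linear_combination (eval x γ' - y * eval x δ') * h + (eval x γ - y * eval x δ) * h' +
    (2 * f * eval x δ * eval x δ' - eval x β * eval x δ' - eval x δ * eval x β') * hy

end Root

namespace HomCoords

section Sections

variable {Y σ M : Type} [AddCommGroup M] {H : HomCoords Y σ M} {d : M} {V : Set Y}

theorem eval_mem_sections {A : MvPolynomial σ ℂ} (hA : IsWeightedHomogeneous H.wt A d)
    (V : Set Y) : (fun z : H.ConeOver V => eval z.2.1 A) ∈ H.sections d V := fun _ =>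
  ⟨0, A, 1, by rwa [zero_add], isWeightedHomogeneous_one _ _, by simp, by simp⟩

theorem glue_mem_sections {k : V → M} {A B : V → MvPolynomial σ ℂ}
    (hA : ∀ p, IsWeightedHomogeneous H.wt (A p) (k p + d))
    (hB : ∀ p, IsWeightedHomogeneous H.wt (B p) (k p)) (hB₀ : ∀ p : V, p.1 ∈ H.basicOpen (B p))
    (hAB : ∀ p q, ∀ z : H.ConeOver V, eval z.2.1 (A p * B q - A q * B p) = 0) :
    (fun z : H.ConeOver V => eval z.2.1 (A z.1) / eval z.2.1 (B z.1)) ∈ H.sections d V := by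
  refine fun p => ⟨k p, A p, B p, hA p, hB p, hB₀ p, fun z hz => ?_⟩
  have hAz := hAB z.1 p z
  simp only [map_sub, map_mul] at hAz
  rw [div_eq_div_iff (hB₀ z.1 _ z.2.2) hz]
  exact sub_eq_zero.1 hAz

theorem WellFormed.exists_regular (hH : H.WellFormed) {t : H.ConeOver V → ℂ}
    (ht : t ∈ H.sections 0 V) : ∃ f ∈ H.regular V, ∀ z : H.ConeOver V, f z.1 = t z := by
  have h : ∀ z : H.ConeOver V, t ⟨z.1, _, (hH.nonempty z.1.1).some_mem⟩ = t z := fun z => by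
    obtain ⟨c, hc⟩ := hH.torus z.1.1 _ z.2.2 _ (hH.nonempty z.1.1).some_mem
    rw [sections_torus_smul ht z.1 z.2 ⟨_, (hH.nonempty z.1.1).some_mem⟩ hc]
    simp
  refine ⟨fun p => t ⟨p, _, (hH.nonempty p.1).some_mem⟩, ?_, h⟩
  change (fun z : H.ConeOver V => t ⟨z.1, _, (hH.nonempty z.1.1).some_mem⟩) ∈ H.sections 0 V
  simpa only [h] using ht

theorem eq_zero_of_mem_sections_of_dense (hH : H.WellFormed) {D : Set Y}
    (hD : @Dense Y H.zariski D) (hV : IsOpen[H.zariski] V) {t : H.ConeOver V → ℂ}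
    (ht : t ∈ H.sections d V) (h₀ : ∀ z : H.ConeOver V, z.1.1 ∈ D → t z = 0) : t = 0 := by
  let _ := H.zariski
  funext z
  obtain ⟨k, A, B, hA, hB, hB₀, hAB⟩ := ht z.1
  by_contra hne
  rw [hAB z (hB₀ _ z.2.2)] at hne
  have hAz : eval z.2.1 A ≠ 0 := fun hAz => hne (by rw [hAz, zero_div, Pi.zero_apply])
  have hz : z.1.1 ∈ V ∩ (H.basicOpen A ∩ H.basicOpen B) :=
    ⟨z.1.2, (hH.mem_basicOpen_iff z.2.2 hA).2 hAz, hB₀⟩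
  obtain ⟨q, ⟨hqV, hqA, hqB⟩, hqD⟩ := hD.inter_open_nonempty _
    (hV.inter ((isOpen_basicOpen hA).inter (isOpen_basicOpen hB))) ⟨_, hz⟩
  obtain ⟨x', hx'⟩ := hH.nonempty q
  have hq := hAB ⟨⟨q, hqV⟩, x', hx'⟩ (hqB x' hx')
  rw [h₀ _ hqD] at hq
  exact div_ne_zero (hqA x' hx') (hqB x' hx') hq.symm

/-- After multiplying numerator and denominator by the denominator, the equation `f B = A` also
holds where the denominator vanishes. -/
theorem exists_mul_eval_eq {f : V → ℂ} (hf : f ∈ H.regular V) (y : V) :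
    ∃ (k : M) (A B : MvPolynomial σ ℂ), IsWeightedHomogeneous H.wt A k ∧
      IsWeightedHomogeneous H.wt B k ∧ y.1 ∈ H.basicOpen B ∧
      ∀ z : H.ConeOver V, f z.1 * eval z.2.1 B = eval z.2.1 A := by
  obtain ⟨k, A, B, hA, hB, hB₀, hAB⟩ := hf y
  rw [add_zero] at hA
  refine ⟨k + k, A * B, B * B, hA.mul hB, hB.mul hB, fun x hx => ?_, fun z => ?_⟩
  · simpa using hB₀ x hx
  · by_cases hz : eval z.2.1 B = 0
    · simp [hz]
    · have hfz : f z.1 = eval z.2.1 A / eval z.2.1 B := hAB z hz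
      simp only [map_mul, hfz]
      field_simp

end Sections

end HomCoords

/-! ### Covers defined by a square root -/

namespace HomCoords

variable {Y Y' σ τ M N : Type} [AddCommGroup M] [AddCommGroup N]

/-- `H` presents `Y` as the zero locus of `y² = s` in the total space of the line bundle `𝒪(d)` over
the variety `Y'`: a point `z` over `p` has the coordinates `(a, y)`, where `a` runs through
coordinates of `p` and `y` is a square root of `s(a)` determined by `a` and `z`. -/
structure IsRootCover (H : HomCoords Y (σ ⊕ Unit) M) (H' : HomCoords Y' σ M) (π : Y → Y') (d : M)
    (s : MvPolynomial σ ℂ) : Prop where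
  wt_eq : H.wt = Sum.elim H'.wt fun _ => d
  wellFormed : H.WellFormed
  base_wellFormed : H'.WellFormed
  isWeightedHomogeneous : IsWeightedHomogeneous H'.wt s (d + d)
  comp_inl_mem : ∀ {z w}, w ∈ H.cone z → w ∘ Sum.inl ∈ H'.cone (π z)
  sq_eq : ∀ {z w}, w ∈ H.cone z → w (Sum.inr ()) ^ 2 = eval (w ∘ Sum.inl) s
  existsUnique_root : ∀ {z a}, a ∈ H'.cone (π z) → ∃! y, Sum.elim a (fun _ => y) ∈ H.cone z
  existsUnique_point : ∀ {p a y}, a ∈ H'.cone p → y ^ 2 = eval a s →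
    ∃! z, π z = p ∧ Sum.elim a (fun _ => y) ∈ H.cone z

namespace IsRootCover

variable {H : HomCoords Y (σ ⊕ Unit) M} {H' : HomCoords Y' σ M} {π : Y → Y'} {d : M}
  {s : MvPolynomial σ ℂ}

theorem branchLocus_eq (h : IsRootCover H H' π d s) :
    branchLocus π = {p | ∀ a ∈ H'.cone p, eval a s = 0} := by
  ext p
  obtain ⟨a, ha⟩ := h.base_wellFormed.nonempty p
  obtain ⟨y, hy⟩ := IsAlgClosed.exists_pow_nat_eq (eval a s) two_pos
  obtain ⟨z₁, ⟨hπ₁, hz₁⟩, huniq₁⟩ := h.existsUnique_point ha hy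
  obtain ⟨z₂, ⟨hπ₂, hz₂⟩, huniq₂⟩ := h.existsUnique_point ha ((neg_sq y).trans hy)
  have hfib : π ⁻¹' {p} = {z₁, z₂} := by
    ext z
    refine ⟨fun hz => ?_, ?_⟩
    · obtain rfl : π z = p := hz
      obtain ⟨y', hy', -⟩ := h.existsUnique_root ha
      rcases sq_eq_sq_iff_eq_or_eq_neg.1 ((h.sq_eq hy').trans hy.symm) with rfl | hneg
      · exact Or.inl (huniq₁ z ⟨rfl, hy'⟩)
      · obtain rfl : y' = -y := hneg
        exact Or.inr (huniq₂ z ⟨rfl, hy'⟩)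
    · rintro (rfl | rfl)
      exacts [hπ₁, hπ₂]
  have hz : z₁ = z₂ ↔ y = 0 := by
    refine ⟨fun hz => ?_, fun hy0 => huniq₂ z₁ ⟨hπ₁, by simpa [hy0] using hz₁⟩⟩
    subst hz
    exact self_eq_neg.1 ((h.existsUnique_root (hπ₁ ▸ ha)).unique hz₁ hz₂)
  have hs : p ∈ {p | ∀ a ∈ H'.cone p, eval a s = 0} ↔ y = 0 := by
    rw [← pow_eq_zero_iff two_ne_zero, hy]
    refine ⟨fun hp => hp a ha, fun hs a' ha' => ?_⟩
    by_contra hne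
    exact (h.base_wellFormed.mem_basicOpen_iff ha' h.isWeightedHomogeneous).2 hne a ha hs
  rw [hs, ← hz, branchLocus, Set.mem_ofPred_eq, hfib]
  refine ⟨fun hcard => by_contra fun hne => hcard (Set.ncard_pair hne), ?_⟩
  rintro rfl
  simp

/-- Multiplication by the coordinate `y = √s`, which turns sections of `𝒪(-d)` on the base into
functions on the cover. -/
noncomputable def mulRoot (h : IsRootCover H H' π d s) {V : Set Y'} :
    (H'.ConeOver V → ℂ) →ₗ[ℂ] (π ⁻¹' V → ℂ) where
  toFun t z := (h.wellFormed.nonempty z.1).some (Sum.inr ()) *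
    t ⟨⟨π z.1, z.2⟩, _, h.comp_inl_mem (h.wellFormed.nonempty z.1).some_mem⟩
  map_add' _ _ := funext fun _ => mul_add _ _ _
  map_smul' _ _ := funext fun _ => mul_left_comm _ _ _

variable {V : Set Y'} {t : H'.ConeOver V → ℂ}

theorem mulRoot_apply (h : IsRootCover H H' π d s) (ht : t ∈ H'.sections (-d) V) (z : π ⁻¹' V)
    {w : σ ⊕ Unit → ℂ} (hw : w ∈ H.cone z.1) :
    h.mulRoot t z = w (Sum.inr ()) * t ⟨⟨π z.1, z.2⟩, _, h.comp_inl_mem hw⟩ := by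
  have hw' := (h.wellFormed.nonempty z.1).some_mem
  obtain ⟨c, hc⟩ := h.wellFormed.torus z.1 _ hw _ hw'
  have hroot := congrFun hc (Sum.inr ())
  have hbase : (h.wellFormed.nonempty z.1).some ∘ Sum.inl =
      fun i => c (Multiplicative.ofAdd (H'.wt i)) * (w ∘ Sum.inl) i := by
    funext i
    have hi := congrFun hc (Sum.inl i)
    rwa [h.wt_eq, Sum.elim_inl] at hi
  have hsmul := sections_torus_smul ht ⟨π z.1, z.2⟩ ⟨_, h.comp_inl_mem hw⟩
    ⟨_, h.comp_inl_mem hw'⟩ hbase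
  change (h.wellFormed.nonempty z.1).some (Sum.inr ()) *
    t ⟨⟨π z.1, z.2⟩, _, h.comp_inl_mem hw'⟩ = _
  rw [hsmul, hroot, h.wt_eq, Sum.elim_inr, ofAdd_neg, map_inv, Units.val_inv_eq_inv_val]
  have := Units.ne_zero (c (Multiplicative.ofAdd d))
  field_simp

theorem mulRoot_mem_regular (h : IsRootCover H H' π d s) (ht : t ∈ H'.sections (-d) V) :
    h.mulRoot t ∈ H.regular (π ⁻¹' V) := by
  intro z
  obtain ⟨k, A, B, hA, hB, hB₀, hAB⟩ := ht ⟨π z.1, z.2⟩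
  have hwt : ∀ i, H.wt (Sum.inl i) = AddMonoidHom.id M (H'.wt i) := fun i => by
    rw [h.wt_eq, Sum.elim_inl, AddMonoidHom.id_apply]
  refine ⟨k, rename Sum.inl A * X (Sum.inr ()), rename Sum.inl B, ?_,
    isWeightedHomogeneous_rename (AddMonoidHom.id M) hwt hB, fun w hw => ?_, ?_⟩
  · convert (isWeightedHomogeneous_rename (AddMonoidHom.id M) hwt hA).mul
      (isWeightedHomogeneous_X ℂ H.wt (Sum.inr ())) using 1
    simp [h.wt_eq]
  · rw [eval_rename]
    exact hB₀ _ (h.comp_inl_mem hw)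
  · rintro ⟨z', w, hw⟩ hBw
    simp only [eval_rename, map_mul, eval_X] at hBw ⊢
    rw [h.mulRoot_apply ht z' hw, hAB ⟨⟨_, z'.2⟩, _, h.comp_inl_mem hw⟩ hBw]
    ring

/-- Near `(a, y)` and `(a, -y)`, the function `f` has denominators which are nonzero there. If the
first one vanishes at `(a, -y)`, use both of them, otherwise the first one twice. -/
theorem exists_quotients (h : IsRootCover H H' π d s) {f : π ⁻¹' V → ℂ}
    (hf : f ∈ H.regular (π ⁻¹' V)) {p : Y'} (hp : p ∈ V) {a : σ → ℂ} (ha : a ∈ H'.cone p) {y : ℂ}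
    (hy : y ^ 2 = eval a s) :
    ∃ (k k' : M) (A B A' B' : MvPolynomial (σ ⊕ Unit) ℂ), IsWeightedHomogeneous H.wt A k ∧
      IsWeightedHomogeneous H.wt B k ∧ IsWeightedHomogeneous H.wt A' k' ∧
      IsWeightedHomogeneous H.wt B' k' ∧
      (∀ z : H.ConeOver (π ⁻¹' V), f z.1 * eval z.2.1 B = eval z.2.1 A) ∧
      (∀ z : H.ConeOver (π ⁻¹' V), f z.1 * eval z.2.1 B' = eval z.2.1 A') ∧
      eval (Sum.elim a fun _ => y) B * eval (Sum.elim a fun _ => -y) B' +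
        eval (Sum.elim a fun _ => -y) B * eval (Sum.elim a fun _ => y) B' ≠ 0 := by
  obtain ⟨z₁, ⟨hπ₁, hz₁⟩, -⟩ := h.existsUnique_point ha hy
  obtain ⟨z₂, ⟨hπ₂, hz₂⟩, -⟩ := h.existsUnique_point ha ((neg_sq y).trans hy)
  obtain ⟨k₁, A₁, B₁, hA₁, hB₁, hB₁0, hf₁⟩ := exists_mul_eval_eq hf
    ⟨z₁, (by rw [Set.mem_preimage, hπ₁]; exact hp)⟩
  obtain ⟨k₂, A₂, B₂, hA₂, hB₂, hB₂0, hf₂⟩ := exists_mul_eval_eq hf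
    ⟨z₂, (by rw [Set.mem_preimage, hπ₂]; exact hp)⟩
  have h₁ := hB₁0 _ hz₁
  have h₂ := hB₂0 _ hz₂
  by_cases h₁' : eval (Sum.elim a fun _ => -y) B₁ = 0
  · refine ⟨k₁, k₂, A₁, B₁, A₂, B₂, hA₁, hB₁, hA₂, hB₂, hf₁, hf₂, ?_⟩
    rw [h₁', zero_mul, add_zero]
    exact mul_ne_zero h₁ h₂
  · refine ⟨k₁, k₁, A₁, B₁, A₁, B₁, hA₁, hB₁, hA₁, hB₁, hf₁, hf₁, ?_⟩
    rw [mul_comm (eval (Sum.elim a fun _ => -y) B₁), ← two_mul]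
    exact mul_ne_zero two_ne_zero (mul_ne_zero h₁ h₁')

theorem exists_local_splitting (h : IsRootCover H H' π d s) {f : π ⁻¹' V → ℂ}
    (hf : f ∈ H.regular (π ⁻¹' V)) (p : V) :
    ∃ (k : M) (N F T : MvPolynomial σ ℂ), IsWeightedHomogeneous H'.wt N k ∧
      IsWeightedHomogeneous H'.wt F (k + 0) ∧ IsWeightedHomogeneous H'.wt T (k + -d) ∧
      p.1 ∈ H'.basicOpen N ∧ ∀ z : H.ConeOver (π ⁻¹' V),
        f z.1 * eval (z.2.1 ∘ Sum.inl) N =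
          eval (z.2.1 ∘ Sum.inl) F + z.2.1 (Sum.inr ()) * eval (z.2.1 ∘ Sum.inl) T := by
  obtain ⟨a, ha⟩ := h.base_wellFormed.nonempty p.1
  obtain ⟨y, hy⟩ := IsAlgClosed.exists_pow_nat_eq (eval a s) two_pos
  obtain ⟨k, k', A, B, A', B', hA, hB, hA', hB', hf, hf', hne⟩ := h.exists_quotients hf p.2 ha hy
  rw [h.wt_eq] at hA hB hA' hB'
  obtain ⟨N, F, T, hN, hF, hT, hNFT⟩ :=
    exists_rationalized_quotient h.isWeightedHomogeneous hA hB hA' hB'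
  refine ⟨k + k', N, F, T, hN, by rwa [add_zero], hT,
    (h.base_wellFormed.mem_basicOpen_iff ha hN).2 ((hNFT a y hy).1.trans_ne hne), fun z => ?_⟩
  have hw : Sum.elim (z.2.1 ∘ Sum.inl) (fun _ => z.2.1 (Sum.inr ())) = z.2.1 :=
    Sum.elim_comp_inl_inr z.2.1
  refine (hNFT _ _ (h.sq_eq z.2.2)).2 _ ?_ ?_ <;> rw [hw]
  exacts [hf z, hf' z]

theorem eq_zero_of_add_mulRoot_eq_zero (h : IsRootCover H H' π d s)
    (hs : @Dense Y' H'.zariski (H'.basicOpen s)) (hV : IsOpen[H'.zariski] V) {f : V → ℂ}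
    (hf : f ∈ H'.regular V) (ht : t ∈ H'.sections (-d) V)
    (h₀ : ∀ z : π ⁻¹' V, f ⟨π z.1, z.2⟩ + h.mulRoot t z = 0) : f = 0 ∧ t = 0 := by
  have hzero : ∀ z : H'.ConeOver V, z.1.1 ∈ H'.basicOpen s → f z.1 = 0 ∧ t z = 0 := by
    rintro ⟨⟨p, hp⟩, a, ha⟩ hps
    refine eq_zero_of_forall_sqrt (hps a ha) fun y hy => ?_
    obtain ⟨z, ⟨rfl, hz⟩, -⟩ := h.existsUnique_point ha hy
    rw [← h₀ ⟨z, hp⟩, h.mulRoot_apply ht ⟨z, hp⟩ hz]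
    rfl
  have hf₀ := eq_zero_of_mem_sections_of_dense h.base_wellFormed hs hV hf
    fun z hz => (hzero z hz).1
  refine ⟨funext fun p => ?_, eq_zero_of_mem_sections_of_dense h.base_wellFormed hs hV ht
    fun z hz => (hzero z hz).2⟩
  obtain ⟨a, ha⟩ := h.base_wellFormed.nonempty p.1
  exact congrFun hf₀ ⟨p, a, ha⟩

theorem exists_eq_add_mulRoot (h : IsRootCover H H' π d s)
    (hs : @Dense Y' H'.zariski (H'.basicOpen s)) (hV : IsOpen[H'.zariski] V) {f : π ⁻¹' V → ℂ}
    (hf : f ∈ H.regular (π ⁻¹' V)) : ∃ f₀ ∈ H'.regular V, ∃ t ∈ H'.sections (-d) V,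
      ∀ z : π ⁻¹' V, f z = f₀ ⟨π z.1, z.2⟩ + h.mulRoot t z := by
  choose k N F T hN hF hT hN₀ hNFT using h.exists_local_splitting hf
  have hcross : ∀ p q (z : H'.ConeOver V), z.1.1 ∈ H'.basicOpen s →
      eval z.2.1 (F p * N q - F q * N p) = 0 ∧ eval z.2.1 (T p * N q - T q * N p) = 0 := by
    rintro p q ⟨⟨r, hr⟩, a, ha⟩ hrs
    refine eq_zero_of_forall_sqrt (hrs a ha) fun y hy => ?_
    obtain ⟨z, ⟨rfl, hz⟩, -⟩ := h.existsUnique_point ha hy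
    have hp := hNFT p ⟨⟨z, hr⟩, _, hz⟩
    have hq := hNFT q ⟨⟨z, hr⟩, _, hz⟩
    simp only [Sum.elim_inr, Sum.elim_comp_inl] at hp hq
    simp only [map_sub, map_mul]
    linear_combination eval a (N p) * hq - eval a (N q) * hp
  have hF' := glue_mem_sections hF hN hN₀ fun p q => congrFun <|
    eq_zero_of_mem_sections_of_dense h.base_wellFormed hs hV
      (eval_mem_sections (d := k p + k q) (.sub (by simpa using (hF p).mul (hN q))
        (by simpa [add_comm] using (hF q).mul (hN p))) V) fun z hz => (hcross p q z hz).1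
  have hT' := glue_mem_sections hT hN hN₀ fun p q => congrFun <|
    eq_zero_of_mem_sections_of_dense h.base_wellFormed hs hV
      (eval_mem_sections (d := k p + k q + -d)
        (.sub (by simpa [add_right_comm] using (hT p).mul (hN q))
          (by rw [add_comm (k p), add_right_comm]; exact (hT q).mul (hN p))) V)
      fun z hz => (hcross p q z hz).2
  obtain ⟨f₀, hf₀, hFN⟩ := h.base_wellFormed.exists_regular hF'
  refine ⟨f₀, hf₀, _, hT', fun z => ?_⟩
  obtain ⟨w, hw⟩ := h.wellFormed.nonempty z.1
  have ha := h.comp_inl_mem hw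
  have hNa := hN₀ ⟨π z.1, z.2⟩ _ ha
  rw [hFN ⟨⟨π z.1, z.2⟩, _, ha⟩, h.mulRoot_apply hT' z hw]
  have hfz : f z * _ = _ := hNFT ⟨π z.1, z.2⟩ ⟨z, w, hw⟩
  field_simp
  exact hfz

/-- The direct image of the structure sheaf of the cover `y² = s` is `𝒪 ⊕ 𝒪(-d) · y`. -/
noncomputable def splitting (h : IsRootCover H H' π d s)
    (hs : @Dense Y' H'.zariski (H'.basicOpen s)) :
    Splitting H H' π d ⟨_, eval_mem_sections h.isWeightedHomogeneous Set.univ⟩ where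
  φ V _ :=
    { toFun := fun t => ⟨h.mulRoot t.1, h.mulRoot_mem_regular t.2⟩
      map_add' := fun t t' => Subtype.ext (map_add h.mulRoot t.1 t'.1)
      map_smul' := fun c t => Subtype.ext (map_smul h.mulRoot c t.1) }
  restriction _ _ _ _ _ t t' htt' z := by
    change _ * t'.1 _ = _
    rw [htt']
    rfl
  linear _ _ f t t' htt' z := by
    change _ * t'.1 _ = _
    rw [htt']
    exact mul_left_comm _ _ _
  mul _ _ t t' z x := by
    obtain ⟨y, hy, -⟩ := h.existsUnique_root x.2
    have hsq : y ^ 2 = eval x.1 s := h.sq_eq hy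
    change h.mulRoot t.1 z * h.mulRoot t'.1 z = eval x.1 s * _ * _
    rw [h.mulRoot_apply t.2 z hy, h.mulRoot_apply t'.2 z hy, ← hsq]
    simp only [Sum.elim_inr, Sum.elim_comp_inl]
    ring
  bijective V hV f hf := by
    obtain ⟨f₀, hf₀, t, ht, hft⟩ := h.exists_eq_add_mulRoot hs hV hf
    refine ⟨(⟨f₀, hf₀⟩, ⟨t, ht⟩), hft, ?_⟩
    rintro ⟨⟨f₁, hf₁⟩, ⟨t₁, ht₁⟩⟩ hft₁
    obtain ⟨hf, ht⟩ := h.eq_zero_of_add_mulRoot_eq_zero hs hV (sub_mem hf₁ hf₀) (sub_mem ht₁ ht)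
      fun z => by
        have h₁ : f z = f₁ ⟨π z.1, z.2⟩ + h.mulRoot t₁ z := hft₁ z
        rw [map_sub, Pi.sub_apply, Pi.sub_apply]
        linear_combination hft z - h₁
    exact Prod.ext (Subtype.ext (sub_eq_zero.1 hf)) (Subtype.ext (sub_eq_zero.1 ht))

end IsRootCover

namespace Splitting

variable {H : HomCoords Y σ M} {H' : HomCoords Y' τ N} {π : Y → Y'} {d : N}
  {s : H'.sections (d + d) Set.univ}

/-- A splitting only depends on the sheaf of regular functions upstairs, and not on the coordinates
by which it is given. -/
def ofRegularEq {σ' M' : Type} [AddCommGroup M'] {K : HomCoords Y σ' M'} (S : Splitting H H' π d s)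
    (h : ∀ V, IsOpen[H'.zariski] V → K.regular (π ⁻¹' V) = H.regular (π ⁻¹' V)) :
    Splitting K H' π d s where
  φ V hV := (Subalgebra.inclusion (h V hV).ge).toLinearMap ∘ₗ S.φ V hV
  restriction := S.restriction
  linear := S.linear
  mul := S.mul
  bijective V hV f hf := S.bijective V hV f (h V hV ▸ hf)

theorem isDoubleCover (S : Splitting H H' π d s) (hH' : H'.WellFormed) (hπ : IsMorphism H H' π)
    (hloc : ∀ p, ∃ V, p ∈ V ∧ IsOpen[H'.zariski] V ∧ IsAffine (H'.restrict V) ∧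
      IsAffine (H.restrict (π ⁻¹' V)) ∧
      ∃ t ∈ H'.sections (-d) V, ∃ t' ∈ H'.sections d V, t * t' = 1) :
    IsDoubleCover H H' π := by
  refine ⟨hπ, fun p => ?_⟩
  obtain ⟨V, hp, hV, hVa, hVa', t, ht, t', ht', htt'⟩ := hloc p
  refine ⟨V, hp, hV, hVa, hVa', 1, one_mem _, (S.φ V hV ⟨t, ht⟩).1, (S.φ V hV ⟨t, ht⟩).2,
    fun f hf => ?_⟩
  obtain ⟨⟨f₀, u⟩, hfu, huniq⟩ := S.bijective V hV f hf
  have hut' : u.1 * t' ∈ H'.sections 0 V := by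
    simpa only [neg_add_cancel] using mul_mem_sections u.2 ht'
  obtain ⟨b, hb, hbu⟩ := hH'.exists_regular hut'
  have htz : ∀ z, t z * t' z = 1 := congrFun htt'
  refine ⟨(f₀, ⟨b, hb⟩), fun z => ?_, ?_⟩
  · have hlin := S.linear V hV ⟨b, hb⟩ ⟨t, ht⟩ u (fun z => by
      simp only [hbu, Pi.mul_apply]
      linear_combination -u.1 z * htz z) z
    rw [hfu z, hlin, Pi.one_apply, mul_one]
  · rintro ⟨f₁, b₁⟩ hfb₁
    have hb₁ := regular_mul_mem_sections b₁.2 ht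
    have hdecomp := huniq (f₁, ⟨_, hb₁⟩) fun z => by
      rw [S.linear V hV b₁ ⟨t, ht⟩ ⟨_, hb₁⟩ (fun _ => rfl) z, hfb₁ z, Pi.one_apply, mul_one]
    obtain ⟨rfl, rfl⟩ := Prod.ext_iff.1 hdecomp
    refine Prod.ext rfl (Subtype.ext (funext fun q => ?_))
    obtain ⟨a, ha⟩ := hH'.nonempty q.1
    have hq : b q = b₁.1 q * t ⟨q, a, ha⟩ * t' ⟨q, a, ha⟩ := hbu ⟨q, a, ha⟩
    simp only
    rw [hq, mul_assoc, htz, mul_one]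

end Splitting

end HomCoords

/-! ### Smoothness of the threefold -/

section Gradient

variable {ι : Type} {p q : MvPolynomial ι ℂ} {a : ι → ℂ}

/-- The gradient of the polynomial `p` at the point `a`. -/
noncomputable def polyGrad (p : MvPolynomial ι ℂ) (a : ι → ℂ) : ι → ℂ :=
  fun i => eval a (pderiv i p)

open scoped Matrix in
theorem dotProduct_polyGrad [Fintype ι] {n : ℕ} (hp : p.IsHomogeneous n) (a : ι → ℂ) :
    a ⬝ᵥ polyGrad p a = n * eval a p := by
  simpa [dotProduct, polyGrad] using congrArg (eval a) hp.sum_X_mul_pderiv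

theorem hasStrictFDerivAt_eval [Fintype ι] (p : MvPolynomial ι ℂ) (a : ι → ℂ) :
    HasStrictFDerivAt (fun x => eval x p)
      (∑ i, polyGrad p a i • (ContinuousLinearMap.proj i : (ι → ℂ) →L[ℂ] ℂ)) a := by
  classical
  induction p using MvPolynomial.induction_on with
  | C c =>
    simp only [eval_C]
    refine (hasStrictFDerivAt_const c a).congr_fderiv ?_
    ext v
    simp [polyGrad]
  | add p q hp hq =>
    simp only [map_add]
    refine (hp.add hq).congr_fderiv ?_
    ext v
    simp [polyGrad, add_mul, Finset.sum_add_distrib]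
  | mul_X p j hp =>
    have h := hp.mul (hasStrictFDerivAt_apply (𝕜 := ℂ) (F' := fun _ : ι => ℂ) j a)
    simp only [map_mul, eval_X]
    refine h.congr_fderiv ?_
    ext v
    simp [polyGrad, pderiv_X, Pi.single_apply, apply_ite (eval a), add_mul, mul_assoc,
      Finset.sum_add_distrib, Finset.mul_sum]

theorem map_nhds_eval_eq [Finite ι] {m : ℕ} {P : Fin m → MvPolynomial ι ℂ}
    (hP : LinearIndependent ℂ fun j => polyGrad (P j) a) :
    Filter.map (fun x j => eval x (P j)) (𝓝 a) = 𝓝 fun j => eval a (P j) := by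
  have := Fintype.ofFinite ι
  let J : Matrix (Fin m) ι ℂ := Matrix.of fun j => polyGrad (P j) a
  have hJ : HasStrictFDerivAt (fun x j => eval x (P j)) J.mulVecLin.toContinuousLinearMap a := by
    refine hasStrictFDerivAt_pi'.2 fun j => (hasStrictFDerivAt_eval (P j) a).congr_fderiv ?_
    ext v
    simp [J, Matrix.mulVec, dotProduct]
  refine hJ.map_nhds_eq_of_surj (Submodule.eq_top_of_finrank_eq ?_)
  rw [Module.finrank_fin_fun]
  exact (LinearIndependent.rank_matrix (M := J) hP).trans (Fintype.card_fin m)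

open Filter in
theorem mem_closure_eval_eq_zero_and_ne_zero [Finite ι] (hp : eval a p = 0)
    (h : LinearIndependent ℂ ![polyGrad p a, polyGrad q a]) :
    a ∈ closure {x | eval x p = 0 ∧ eval x q ≠ 0} := by
  have hmap := map_nhds_eval_eq (P := ![p, q]) (a := a) <| by
    convert h using 1
    funext j
    fin_cases j <;> rfl
  have hpq : Tendsto (fun c : ℂ => ![0, c]) (𝓝 (eval a q)) (𝓝 fun j => eval a (![p, q] j)) := by
    refine tendsto_pi_nhds.2 fun j => ?_
    fin_cases j
    · simp [hp]
    · exact tendsto_id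
  have hne : ∃ᶠ c in 𝓝 (eval a q), c ≠ 0 :=
    mem_closure_iff_frequently.1 (dense_compl_singleton (0 : ℂ) (eval a q))
  have hval : ∃ᶠ y in 𝓝 fun j => eval a (![p, q] j), y 0 = 0 ∧ y 1 ≠ 0 :=
    hpq.frequently (hne.mono fun c hc => ⟨rfl, hc⟩)
  rw [← hmap] at hval
  exact mem_closure_iff_frequently.2 (frequently_map.1 hval)

end Gradient

open scoped Matrix in
theorem crossProduct_eq_zero_of_apply_eq_zero {a v w : Fin 3 → ℂ} (hv : a ⬝ᵥ v = 0)
    (hw : a ⬝ᵥ w = 0) {k : Fin 3} (hk : a k ≠ 0) (h : (v ⨯₃ w) k = 0) : v ⨯₃ w = 0 := by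
  have hcross : a ⨯₃ (v ⨯₃ w) = 0 := by
    rw [cross_cross_eq_smul_sub_smul', hw, dotProduct_comm, hv, zero_smul, zero_smul, sub_zero]
  generalize v ⨯₃ w = n at h hcross ⊢
  rw [cross_apply] at hcross
  have h₀ : a 1 * n 2 - a 2 * n 1 = 0 := congrFun hcross 0
  have h₁ : a 2 * n 0 - a 0 * n 2 = 0 := congrFun hcross 1
  have h₂ : a 0 * n 1 - a 1 * n 0 = 0 := congrFun hcross 2
  funext i
  apply mul_left_cancel₀ hk
  fin_cases k <;> fin_cases i <;> simp_all

theorem exists_binary_quadratic_zero (A B D : ℂ) :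
    ∃ u v : ℂ, (u ≠ 0 ∨ v ≠ 0) ∧ A * u ^ 2 + B * u * v + D * v ^ 2 = 0 := by
  by_cases hA : A = 0
  · exact ⟨1, 0, by simp, by simp [hA]⟩
  · obtain ⟨r, hr⟩ := IsAlgClosed.exists_pow_nat_eq (B ^ 2 - 4 * A * D) two_pos
    exact ⟨-B + r, 2 * A, Or.inr (mul_ne_zero two_ne_zero hA), by linear_combination A * hr⟩

/-- The point of `ℙ⁴` with coordinates `(a₀, a₁, a₂, u, v)`. -/
def joinVec (a : Fin 3 → ℂ) (u v : ℂ) : Fin 5 → ℂ := ![a 0, a 1, a 2, u, v]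

section JoinVec

variable (a b : Fin 3 → ℂ) (u v u' v' : ℂ)

theorem joinVec_castLE (h : 3 ≤ 5) (i : Fin 3) : joinVec a u v (Fin.castLE h i) = a i := by
  fin_cases i <;> rfl

theorem joinVec_comp_castLE (h : 3 ≤ 5) : joinVec a u v ∘ Fin.castLE h = a :=
  funext (joinVec_castLE a u v h)

theorem joinVec_three : joinVec a u v 3 = u := rfl

theorem joinVec_four : joinVec a u v 4 = v := rfl

theorem projL_joinVec : projL (joinVec a u v) = a :=
  funext (joinVec_castLE a u v _)

theorem joinVec_projL (x : Fin 5 → ℂ) : joinVec (projL x) (x 3) (x 4) = x := by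
  funext i
  fin_cases i <;> rfl

theorem smul_joinVec (c : ℂ) : c • joinVec a u v = joinVec (c • a) (c * u) (c * v) := by
  funext i
  fin_cases i <;> rfl

theorem joinVec_add :
    joinVec a u v + joinVec b u' v' = joinVec (a + b) (u + u') (v + v') := by
  funext i
  fin_cases i <;> rfl

variable {a b u v u' v'}

theorem joinVec_inj : joinVec a u v = joinVec b u' v' ↔ a = b ∧ u = u' ∧ v = v' := by
  refine ⟨fun h => ⟨?_, congrFun h 3, congrFun h 4⟩, ?_⟩
  · rw [← projL_joinVec a u v, h, projL_joinVec]
  · rintro ⟨rfl, rfl, rfl⟩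
    rfl

theorem joinVec_eq_zero_iff : joinVec a u v = 0 ↔ a = 0 ∧ u = 0 ∧ v = 0 := by
  rw [← joinVec_inj]
  exact Eq.congr_right (by funext i; fin_cases i <;> rfl)

end JoinVec

/-- The family of quadratic forms `l₁ u² + l₂ v² + 2 l₃ u v` in `(u, v)`, as a linear form on `ℙ²`
for given `(u, v)`. -/
noncomputable def conicForm (l₁ l₂ l₃ : MvPolynomial (Fin 3) ℂ) (u v : ℂ) :
    MvPolynomial (Fin 3) ℂ :=
  C (u ^ 2) * l₁ + C (v ^ 2) * l₂ + C (2 * u * v) * l₃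

/-- Three linear forms and a cubic form, as in the normal form of a cubic threefold with an
involution of non-Eckardt type. -/
structure IsNormalForm (l₁ l₂ l₃ g : MvPolynomial (Fin 3) ℂ) : Prop where
  left : l₁.IsHomogeneous 1
  right : l₂.IsHomogeneous 1
  mixed : l₃.IsHomogeneous 1
  cubic : g.IsHomogeneous 3

/-- The quadratic form of the conic fibration is nonzero at every point of the cubic curve `V(g)`,
so that the fibres there are honest conics. -/
structure HasConicFibres (l₁ l₂ l₃ g : MvPolynomial (Fin 3) ℂ) : Prop
    extends IsNormalForm l₁ l₂ l₃ g where
  exists_conicForm_ne_zero : ∀ a, a ≠ 0 → eval a g = 0 →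
    ∃ u v, eval a (conicForm l₁ l₂ l₃ u v) ≠ 0

section Threefold

variable {l₁ l₂ l₃ g : MvPolynomial (Fin 3) ℂ} {a : Fin 3 → ℂ} {u v : ℂ}

theorem eval_conicForm : eval a (conicForm l₁ l₂ l₃ u v) =
    eval a l₁ * u ^ 2 + eval a l₂ * v ^ 2 + 2 * eval a l₃ * u * v := by
  simp only [conicForm, map_add, map_mul, eval_C]
  ring

theorem eval_joinVec_threefoldEq : eval (joinVec a u v) (threefoldEq l₁ l₂ l₃ g) =
    eval a (conicForm l₁ l₂ l₃ u v) + eval a g := by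
  simp only [threefoldEq, map_add, map_mul, map_pow, eval_rename, joinVec_comp_castLE, eval_X,
    joinVec_three, joinVec_four, map_ofNat, eval_conicForm]

theorem exists_eq_castLE_or (h : 3 ≤ 5) (i : Fin 5) :
    (∃ j, i = Fin.castLE h j) ∨ i = 3 ∨ i = 4 := by
  decide +revert

theorem castLE_ne_three (h : 3 ≤ 5) (j : Fin 3) : Fin.castLE h j ≠ 3 := by
  decide +revert

theorem castLE_ne_four (h : 3 ≤ 5) (j : Fin 3) : Fin.castLE h j ≠ 4 := by
  decide +revert

theorem pderiv_rename_eq_zero {σ τ : Type} {f : σ → τ} {i : τ} (hi : ∀ j, f j ≠ i)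
    (p : MvPolynomial σ ℂ) : pderiv i (rename f p) = 0 := by
  classical
  refine pderiv_eq_zero_of_notMem_vars fun hv => ?_
  obtain ⟨j, -, hj⟩ := Finset.mem_image.1 (vars_rename _ _ hv)
  exact hi j hj

theorem polyGrad_threefoldEq : polyGrad (threefoldEq l₁ l₂ l₃ g) (joinVec a u v) =
    joinVec (polyGrad (conicForm l₁ l₂ l₃ u v + g) a) (2 * (eval a l₁ * u + eval a l₃ * v))
      (2 * (eval a l₃ * u + eval a l₂ * v)) := by
  have h5 : 3 ≤ 5 := by norm_num
  have h2 : ∀ i : Fin 5, pderiv i (2 : MvPolynomial (Fin 5) ℂ) = 0 := fun i => by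
    rw [← map_ofNat C 2, pderiv_C]
  funext i
  rcases exists_eq_castLE_or h5 i with ⟨j, rfl⟩ | rfl | rfl
  · simp [polyGrad, threefoldEq, conicForm, pderiv_rename (Fin.castLE_injective h5), eval_rename,
      joinVec_comp_castLE, joinVec_castLE, joinVec_three, joinVec_four, pderiv_X,
      (castLE_ne_three h5 j).symm, (castLE_ne_four h5 j).symm, h2]
    ring
  · simp [polyGrad, threefoldEq, pderiv_rename_eq_zero (castLE_ne_three h5), eval_rename,
      joinVec_comp_castLE, joinVec_three, joinVec_four, pderiv_X, h2]
    ring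
  · simp [polyGrad, threefoldEq, pderiv_rename_eq_zero (castLE_ne_four h5), eval_rename,
      joinVec_comp_castLE, joinVec_three, joinVec_four, pderiv_X, h2]
    ring

theorem polyGrad_add_ne_zero (hX : IsSmoothHypersurface (threefoldEq l₁ l₂ l₃ g))
    (h0 : ¬(a = 0 ∧ u = 0 ∧ v = 0)) (hg : eval a g = 0)
    (h₁ : eval a l₁ * u + eval a l₃ * v = 0) (h₂ : eval a l₃ * u + eval a l₂ * v = 0) :
    polyGrad (conicForm l₁ l₂ l₃ u v + g) a ≠ 0 := by
  obtain ⟨i, hi⟩ := hX (joinVec a u v) (joinVec_eq_zero_iff.not.2 h0) (by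
    rw [eval_joinVec_threefoldEq, eval_conicForm]
    linear_combination u * h₁ + v * h₂ + hg)
  intro hgrad
  refine hi (congrFun (?_ : polyGrad (threefoldEq l₁ l₂ l₃ g) (joinVec a u v) = 0) i)
  rw [polyGrad_threefoldEq, hgrad, h₁, h₂, mul_zero, joinVec_eq_zero_iff]
  exact ⟨rfl, rfl, rfl⟩

theorem polyGrad_cubic_ne_zero (hX : IsSmoothHypersurface (threefoldEq l₁ l₂ l₃ g)) (ha : a ≠ 0)
    (hg : eval a g = 0) : polyGrad g a ≠ 0 := by
  simpa [conicForm] using polyGrad_add_ne_zero hX (u := 0) (v := 0) (fun h => ha h.1) hg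
    (by simp) (by simp)

theorem isSmoothHypersurface_cubic (hX : IsSmoothHypersurface (threefoldEq l₁ l₂ l₃ g)) :
    IsSmoothHypersurface g :=
  fun _ ha hg => Function.ne_iff.1 (polyGrad_cubic_ne_zero hX ha hg)

namespace IsNormalForm

theorem isHomogeneous_conicForm (h : IsNormalForm l₁ l₂ l₃ g) (u v : ℂ) :
    (conicForm l₁ l₂ l₃ u v).IsHomogeneous 1 :=
  ((h.left.C_mul _).add (h.right.C_mul _)).add (h.mixed.C_mul _)

theorem isHomogeneous_conic (h : IsNormalForm l₁ l₂ l₃ g) :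
    (l₁ * l₂ - l₃ ^ 2).IsHomogeneous 2 :=
  (h.left.mul h.right).sub (h.mixed.pow 2)

/-- If the gradients were parallel, then rescaling `a` by the square root of the factor of
proportionality would produce a singular point `(t a, u, v)` of the threefold. -/
theorem linearIndependent_polyGrad_conicForm (h : IsNormalForm l₁ l₂ l₃ g)
    (hX : IsSmoothHypersurface (threefoldEq l₁ l₂ l₃ g)) (ha : a ≠ 0) (hg : eval a g = 0)
    (huv : ¬(u = 0 ∧ v = 0)) (h₁ : eval a l₁ * u + eval a l₃ * v = 0)
    (h₂ : eval a l₃ * u + eval a l₂ * v = 0) :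
    LinearIndependent ℂ ![polyGrad g a, polyGrad (conicForm l₁ l₂ l₃ u v) a] := by
  refine (LinearIndependent.pair_iff' (polyGrad_cubic_ne_zero hX ha hg)).2 fun c hc => ?_
  obtain ⟨t, ht⟩ := IsAlgClosed.exists_pow_nat_eq (-c) two_pos
  refine polyGrad_add_ne_zero hX (a := t • a) (u := u) (v := v) (fun h0 => huv h0.2)
    (by rw [eval_smul_of_isHomogeneous h.cubic, hg, mul_zero]) ?_ ?_ (funext fun i => ?_)
  · rw [eval_smul_of_isHomogeneous h.left, eval_smul_of_isHomogeneous h.mixed]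
    linear_combination t * h₁
  · rw [eval_smul_of_isHomogeneous h.mixed, eval_smul_of_isHomogeneous h.right]
    linear_combination t * h₂
  · have hci : c * eval a (pderiv i g) = eval a (pderiv i (conicForm l₁ l₂ l₃ u v)) := congrFun hc i
    rw [polyGrad, map_add, map_add, eval_smul_of_isHomogeneous h.cubic.pderiv,
      eval_smul_of_isHomogeneous (h.isHomogeneous_conicForm u v).pderiv, ← hci, Pi.zero_apply]
    linear_combination eval a (pderiv i g) * ht

theorem hasConicFibres (h : IsNormalForm l₁ l₂ l₃ g)
    (hX : IsSmoothHypersurface (threefoldEq l₁ l₂ l₃ g)) : HasConicFibres l₁ l₂ l₃ g := by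
  refine ⟨h, fun a ha hg => ?_⟩
  by_contra! hq
  simp only [eval_conicForm] at hq
  have h₁ : eval a l₁ = 0 := by linear_combination hq 1 0
  have h₂ : eval a l₂ = 0 := by linear_combination hq 0 1
  have h₃ : eval a l₃ = 0 := by linear_combination (hq 1 1 - h₁ - h₂) / 2
  obtain ⟨k, hk⟩ := Function.ne_iff.1 ha
  obtain ⟨u, v, huv, huv₀⟩ := exists_binary_quadratic_zero
    (crossProduct (polyGrad g a) (polyGrad l₁ a) k)
    (2 * crossProduct (polyGrad g a) (polyGrad l₃ a) k)
    (crossProduct (polyGrad g a) (polyGrad l₂ a) k)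
  refine crossProduct_ne_zero_iff_linearIndependent.2
    (h.linearIndependent_polyGrad_conicForm hX ha hg (u := u) (v := v) (by tauto)
      (by rw [h₁, h₃]; ring) (by rw [h₂, h₃]; ring))
    (crossProduct_eq_zero_of_apply_eq_zero (a := a) ?_ ?_ hk ?_)
  · rw [dotProduct_polyGrad h.cubic, hg, mul_zero]
  · rw [dotProduct_polyGrad (h.isHomogeneous_conicForm u v), eval_conicForm, h₁, h₂, h₃]
    ring
  · have hgrad : polyGrad (conicForm l₁ l₂ l₃ u v) a =
        u ^ 2 • polyGrad l₁ a + v ^ 2 • polyGrad l₂ a + (2 * u * v) • polyGrad l₃ a := by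
      funext i
      simp [polyGrad, conicForm]
    rw [hgrad]
    simp only [map_add, map_smul, Pi.add_apply, Pi.smul_apply, smul_eq_mul]
    linear_combination huv₀

end IsNormalForm

namespace HasConicFibres

/-- The quadratic form `l₁ X² + l₂ Y² + 2 l₃ X Y` at `a` is `c (v X - u Y)²`. -/
theorem exists_rank_one (h : HasConicFibres l₁ l₂ l₃ g) (ha : a ≠ 0) (hg : eval a g = 0)
    (hs : eval a (l₁ * l₂ - l₃ ^ 2) = 0) : ∃ u v c : ℂ, ¬(u = 0 ∧ v = 0) ∧ c ≠ 0 ∧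
      eval a l₁ = c * v ^ 2 ∧ eval a l₂ = c * u ^ 2 ∧ eval a l₃ = -(c * u * v) := by
  obtain ⟨b, c, hbc⟩ := h.exists_conicForm_ne_zero a ha hg
  rw [eval_conicForm] at hbc
  simp only [map_sub, map_mul, map_pow] at hs
  by_cases h₁ : eval a l₁ = 0
  · have h₃ : eval a l₃ = 0 := by simpa [h₁] using hs
    refine ⟨1, 0, eval a l₂, by simp, fun h₂ => hbc (by simp [h₁, h₂, h₃]), ?_, ?_, ?_⟩ <;>
      simp [h₁, h₃]
  · refine ⟨-eval a l₃ / eval a l₁, 1, eval a l₁, by simp, h₁, by simp, ?_, ?_⟩ <;> field_simp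
    linear_combination hs

theorem linearIndependent_polyGrad_conic (h : HasConicFibres l₁ l₂ l₃ g)
    (hX : IsSmoothHypersurface (threefoldEq l₁ l₂ l₃ g)) (ha : a ≠ 0) (hg : eval a g = 0)
    (hs : eval a (l₁ * l₂ - l₃ ^ 2) = 0) :
    LinearIndependent ℂ ![polyGrad g a, polyGrad (l₁ * l₂ - l₃ ^ 2) a] := by
  obtain ⟨u, v, c, huv, hc, h₁, h₂, h₃⟩ := h.exists_rank_one ha hg hs
  have hgrad : polyGrad (l₁ * l₂ - l₃ ^ 2) a = c • polyGrad (conicForm l₁ l₂ l₃ u v) a := by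
    funext i
    simp only [polyGrad, conicForm, map_sub, map_add, map_mul, map_pow, Derivation.leibniz,
      Derivation.leibniz_pow, smul_eq_mul, nsmul_eq_mul, pderiv_C, mul_zero, add_zero, eval_C,
      Pi.smul_apply, map_natCast, h₁, h₂, h₃]
    push_cast
    ring
  have hpair := h.linearIndependent_polyGrad_conicForm hX ha hg huv
    (by rw [h₁, h₃]; ring) (by rw [h₂, h₃]; ring)
  rw [LinearIndependent.pair_iff'] at hpair ⊢
  · intro b hb
    refine hpair (c⁻¹ * b) ?_
    rw [mul_smul, hb, hgrad, inv_smul_smul₀ hc]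
  all_goals exact polyGrad_cubic_ne_zero hX ha hg

theorem mem_closure_cone_diff (h : HasConicFibres l₁ l₂ l₃ g)
    (hX : IsSmoothHypersurface (threefoldEq l₁ l₂ l₃ g)) (ha : a ≠ 0) (hg : eval a g = 0) :
    a ∈ closure {x | eval x g = 0 ∧ eval x (l₁ * l₂ - l₃ ^ 2) ≠ 0} := by
  by_cases hs : eval a (l₁ * l₂ - l₃ ^ 2) = 0
  · exact mem_closure_eval_eq_zero_and_ne_zero hg (h.linearIndependent_polyGrad_conic hX ha hg hs)
  · exact subset_closure ⟨hg, hs⟩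

/-- The conic and the cubic have no common component because they meet transversally. -/
theorem dense_basicOpen_conic (h : HasConicFibres l₁ l₂ l₃ g)
    (hX : IsSmoothHypersurface (threefoldEq l₁ l₂ l₃ g)) :
    @Dense _ (cubicCoords g).zariski ((cubicCoords g).basicOpen (l₁ * l₂ - l₃ ^ 2)) := by
  let _ := (cubicCoords g).zariski
  have hwf := (HomCoords.projSpace_wellFormed 3).restrict (hypersurface g)
  refine fun p => (cubicCoords g).isTopologicalBasis_basicOpen.mem_closure_iff.2 ?_
  rintro _ ⟨k, B, hB, rfl⟩ hpB
  obtain ⟨a, ha⟩ := hwf.nonempty p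
  obtain ⟨x, hxB, hxg, hxs⟩ := mem_closure_iff.1
    (h.mem_closure_cone_diff hX ha.1 (p.2 a ha.2)) {x | eval x B ≠ 0}
    (isOpen_ne_fun (continuous_eval B) continuous_const) (hpB a ha)
  have hx : x ≠ 0 := by
    rintro rfl
    refine hxs ?_
    rw [← zero_smul ℂ 0, eval_smul_of_isHomogeneous h.isHomogeneous_conic]
    simp
  have hmem := HomCoords.mk_mem_projSpace_cone hx
  let q : hypersurface g := ⟨Projectivization.mk ℂ x hx, (mem_hypersurface_iff h.cubic hmem).2 hxg⟩
  exact ⟨q, (hwf.mem_basicOpen_iff (y := q) hmem hB).2 hxB,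
    (hwf.mem_basicOpen_iff (y := q) hmem
      (isWeightedHomogeneous_of_isHomogeneous (fun _ => rfl) h.isHomogeneous_conic)).2 hxs⟩

end HasConicFibres

end Threefold

/-! ### Lines in the fibres of the conic fibration -/

section BlowUp

/-- The equations of the incidence variety `Bl_L ℙ⁴ = {(x, p) | projL x ∈ p}`. -/
noncomputable def incidenceEq (i j : Fin 3) : MvPolynomial (Fin 5 ⊕ Fin 3) ℂ :=
  X (Sum.inl (Fin.castLE (by norm_num) i)) * X (Sum.inr j) -
    X (Sum.inl (Fin.castLE (by norm_num) j)) * X (Sum.inr i)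

/-- Equations of the strict transform: if `projL x = t a`, then the equation of the threefold at `x`
is `t` times `conicForm + t² g` at `a`, where `t` is the quotient of the `i`-th coordinates of `x`
and `a`. -/
noncomputable def strictTransformEq (l₁ l₂ l₃ g : MvPolynomial (Fin 3) ℂ) (i : Fin 3) :
    MvPolynomial (Fin 5 ⊕ Fin 3) ℂ :=
  X (Sum.inr i) ^ 2 * (rename Sum.inr l₁ * X (Sum.inl 3) ^ 2 +
    rename Sum.inr l₂ * X (Sum.inl 4) ^ 2 +
    C 2 * (rename Sum.inr l₃ * (X (Sum.inl 3) * X (Sum.inl 4)))) +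
  X (Sum.inl (Fin.castLE (by norm_num) i)) ^ 2 * rename Sum.inr g

variable {l₁ l₂ l₃ g : MvPolynomial (Fin 3) ℂ} {x : ℙ ℂ (Fin 5 → ℂ)} {p : ℙ ℂ (Fin 3 → ℂ)}
  {w : Fin 5 → ℂ} {a : Fin 3 → ℂ}

theorem eval_incidenceEq (i j : Fin 3) :
    eval (Sum.elim w a) (incidenceEq i j) = projL w i * a j - projL w j * a i := by
  simp [incidenceEq, projL]

theorem eval_strictTransformEq (i : Fin 3) :
    eval (Sum.elim w a) (strictTransformEq l₁ l₂ l₃ g i) =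
      a i ^ 2 * eval a (conicForm l₁ l₂ l₃ (w 3) (w 4)) + projL w i ^ 2 * eval a g := by
  simp only [strictTransformEq, map_add, map_mul, map_pow, eval_X, eval_C, eval_rename,
    Sum.elim_inl, Sum.elim_inr, Sum.elim_comp_inr, eval_conicForm, projL]
  ring

theorem isWeightedHomogeneous_incidenceEq (i j : Fin 3) :
    IsWeightedHomogeneous ((HomCoords.projSpace 5).prod (HomCoords.projSpace 3)).wt
      (incidenceEq i j) ((1 : ℤ), (1 : ℤ)) :=
  ((isWeightedHomogeneous_X ℂ _ _).mul (isWeightedHomogeneous_X ℂ _ _)).sub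
    ((isWeightedHomogeneous_X ℂ _ _).mul (isWeightedHomogeneous_X ℂ _ _))

theorem IsNormalForm.isWeightedHomogeneous_strictTransformEq (h : IsNormalForm l₁ l₂ l₃ g)
    (i : Fin 3) :
    IsWeightedHomogeneous ((HomCoords.projSpace 5).prod (HomCoords.projSpace 3)).wt
      (strictTransformEq l₁ l₂ l₃ g i) ((2 : ℤ), (3 : ℤ)) := by
  set wt := ((HomCoords.projSpace 5).prod (HomCoords.projSpace 3)).wt
  have hx (j : Fin 5) : IsWeightedHomogeneous wt (X (Sum.inl j) : MvPolynomial _ ℂ)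
      ((1 : ℤ), (0 : ℤ)) := isWeightedHomogeneous_X ℂ _ _
  have ha (j : Fin 3) : IsWeightedHomogeneous wt (X (Sum.inr j) : MvPolynomial _ ℂ)
      ((0 : ℤ), (1 : ℤ)) := isWeightedHomogeneous_X ℂ _ _
  have hform {f : MvPolynomial (Fin 3) ℂ} {n : ℕ} (hf : f.IsHomogeneous n) :
      IsWeightedHomogeneous wt (rename Sum.inr f) ((0 : ℤ), (n : ℤ)) := by
    have hf' := isWeightedHomogeneous_rename_of_isHomogeneous (w := wt) (f := Sum.inr)
      (m := ((0 : ℤ), (1 : ℤ))) (fun _ => rfl) hf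
    rwa [Prod.smul_mk, smul_zero, nsmul_one] at hf'
  have hconic : IsWeightedHomogeneous wt (rename Sum.inr l₁ * X (Sum.inl 3) ^ 2 +
      rename Sum.inr l₂ * X (Sum.inl 4) ^ 2 +
      C 2 * (rename Sum.inr l₃ * (X (Sum.inl 3) * X (Sum.inl 4)))) ((2 : ℤ), (1 : ℤ)) :=
    (((hform h.left).mul ((hx 3).pow 2)).add ((hform h.right).mul ((hx 4).pow 2))).add
      (((hform h.mixed).mul ((hx 3).mul (hx 4))).C_mul 2)
  exact (((ha i).pow 2).mul hconic).add (((hx _).pow 2).mul (hform h.cubic))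

theorem IsNormalForm.isHomogeneous_threefoldEq (h : IsNormalForm l₁ l₂ l₃ g) :
    (threefoldEq l₁ l₂ l₃ g).IsHomogeneous 3 := by
  have hX (i : Fin 5) : (X i : MvPolynomial (Fin 5) ℂ).IsHomogeneous 1 := isHomogeneous_X ℂ i
  rw [threefoldEq, ← map_ofNat C 2]
  exact (((h.left.rename_isHomogeneous.mul ((hX 3).pow 2)).add
    (h.right.rename_isHomogeneous.mul ((hX 4).pow 2))).add
    (((h.mixed.rename_isHomogeneous.C_mul 2).mul (hX 3)).mul (hX 4))).add
    h.cubic.rename_isHomogeneous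

theorem eval_eq_zero_of_mem_blowUpL {F : MvPolynomial (Fin 5) ℂ}
    {P : MvPolynomial (Fin 5 ⊕ Fin 3) ℂ} {k : ℤ × ℤ}
    (hP : IsWeightedHomogeneous ((HomCoords.projSpace 5).prod (HomCoords.projSpace 3)).wt P k)
    (h : ∀ (w : Fin 5 → ℂ) (a : Fin 3 → ℂ) (t : ℂ), t ≠ 0 → projL w = t • a → eval w F = 0 →
      eval (Sum.elim w a) P = 0)
    (hxp : (x, p) ∈ blowUpL (hypersurface F)) (hw : w ∈ (HomCoords.projSpace 5).cone x)
    (ha : a ∈ (HomCoords.projSpace 3).cone p) : eval (Sum.elim w a) P = 0 := by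
  have hwf := (HomCoords.projSpace_wellFormed 5).prod (HomCoords.projSpace_wellFormed 3)
  let _ := ((HomCoords.projSpace 5).prod (HomCoords.projSpace 3)).zariski
  refine closure_minimal ?_ (hwf.isClosed_vanishing hP) hxp (Sum.elim w a) ⟨hw, ha⟩
  rintro ⟨q, r⟩ ⟨hq, ⟨x', hx', hx'₀⟩, hqr⟩ b ⟨hb₁, hb₂⟩
  rw [← Sum.elim_comp_inl_inr b]
  obtain ⟨t, ht⟩ := (HomCoords.mem_submodule_iff_of_mem_cone hb₂).1 (hqr _ hb₁.2)
  refine h _ _ t ?_ ht.symm (hq _ hb₁.2)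
  rintro rfl
  obtain ⟨c, rfl⟩ := (HomCoords.mem_submodule_iff_of_mem_cone hb₁).1 hx'
  refine hx'₀ ?_
  change c • projL (fun i => b (Sum.inl i)) = 0
  rw [← ht, zero_smul, smul_zero]

theorem exists_projL_eq_smul_of_mem_blowUpL {F : MvPolynomial (Fin 5) ℂ}
    (hxp : (x, p) ∈ blowUpL (hypersurface F)) (hw : w ∈ (HomCoords.projSpace 5).cone x)
    (ha : a ∈ (HomCoords.projSpace 3).cone p) : ∃ t : ℂ, projL w = t • a := by
  obtain ⟨i, hi⟩ := Function.ne_iff.1 ha.1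
  rw [Pi.zero_apply] at hi
  refine ⟨projL w i / a i, funext fun j => ?_⟩
  have hij := eval_eq_zero_of_mem_blowUpL (isWeightedHomogeneous_incidenceEq i j)
    (fun w a t _ hw _ => by
      rw [eval_incidenceEq, hw, Pi.smul_apply, Pi.smul_apply, smul_eq_mul, smul_eq_mul]
      ring) hxp hw ha
  rw [eval_incidenceEq] at hij
  rw [Pi.smul_apply, smul_eq_mul]
  field_simp
  linear_combination -hij

namespace IsNormalForm

theorem eval_smul_conicForm (h : IsNormalForm l₁ l₂ l₃ g) (t u v : ℂ) :
    eval (joinVec (t • a) u v) (threefoldEq l₁ l₂ l₃ g) =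
      t * (eval a (conicForm l₁ l₂ l₃ u v) + t ^ 2 * eval a g) := by
  rw [eval_joinVec_threefoldEq, eval_smul_of_isHomogeneous (h.isHomogeneous_conicForm u v),
    eval_smul_of_isHomogeneous h.cubic]
  ring

theorem eval_conicForm_eq_zero_of_mem_blowUpL (h : IsNormalForm l₁ l₂ l₃ g)
    (hxp : (x, p) ∈ blowUpL (hypersurface (threefoldEq l₁ l₂ l₃ g)))
    (hw : w ∈ (HomCoords.projSpace 5).cone x) (ha : a ∈ (HomCoords.projSpace 3).cone p)
    (hg : eval a g = 0) : eval a (conicForm l₁ l₂ l₃ (w 3) (w 4)) = 0 := by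
  obtain ⟨i, hi⟩ := Function.ne_iff.1 ha.1
  have hstrict := eval_eq_zero_of_mem_blowUpL (h.isWeightedHomogeneous_strictTransformEq i)
    (fun w a t ht hw hF => by
      rw [← joinVec_projL w, hw, h.eval_smul_conicForm] at hF
      rw [eval_strictTransformEq, hw, Pi.smul_apply, smul_eq_mul]
      linear_combination a i ^ 2 * (mul_eq_zero.1 hF).resolve_left ht) hxp hw ha
  rw [eval_strictTransformEq, hg, mul_zero, add_zero] at hstrict
  exact (mul_eq_zero.1 hstrict).resolve_left (pow_ne_zero 2 hi)

/-- The points `(s a, u, v)` with `s ≠ 0` lie on the threefold and outside `L`; the point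
`(0, u, v)` of `L` is their limit. -/
theorem mem_blowUpL_of_conic (h : IsNormalForm l₁ l₂ l₃ g) {t u v : ℂ}
    (hx : joinVec (t • a) u v ∈ (HomCoords.projSpace 5).cone x)
    (ha : a ∈ (HomCoords.projSpace 3).cone p) (hg : eval a g = 0)
    (hq : eval a (conicForm l₁ l₂ l₃ u v) = 0) :
    (x, p) ∈ blowUpL (hypersurface (threefoldEq l₁ l₂ l₃ g)) := by
  have hwf := (HomCoords.projSpace_wellFormed 5).prod (HomCoords.projSpace_wellFormed 3)
  let _ := ((HomCoords.projSpace 5).prod (HomCoords.projSpace 3)).zariski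
  refine (HomCoords.isTopologicalBasis_basicOpen _).mem_closure_iff.2 ?_
  rintro _ ⟨k, B, hB, rfl⟩ hxB
  have hcont : Continuous fun s : ℂ => eval (Sum.elim (joinVec (s • a) u v) a) B := by
    refine (continuous_eval B).comp (continuous_pi (Sum.rec (fun i => ?_) fun i => ?_))
    · rcases exists_eq_castLE_or (by norm_num) i with ⟨j, rfl⟩ | rfl | rfl
      · simp only [Sum.elim_inl, joinVec_castLE]
        fun_prop
      all_goals exact continuous_const
    · exact continuous_const
  obtain ⟨s, hsB, hs⟩ := (dense_compl_singleton (0 : ℂ)).inter_open_nonempty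
    {s | eval (Sum.elim (joinVec (s • a) u v) a) B ≠ 0}
    (isOpen_ne_fun hcont continuous_const) ⟨t, hxB _ ⟨hx, ha⟩⟩
  have hsa : s • a ≠ 0 := smul_ne_zero hs ha.1
  have hne : joinVec (s • a) u v ≠ 0 := joinVec_eq_zero_iff.not.2 fun h₀ => hsa h₀.1
  have hmem := HomCoords.mk_mem_projSpace_cone hne
  refine ⟨(Projectivization.mk ℂ _ hne, p),
    (hwf.mem_basicOpen_iff ⟨hmem, ha⟩ hB).2 hsB,
    (mem_hypersurface_iff h.isHomogeneous_threefoldEq hmem).2 ?_, ⟨_, hmem.2, ?_⟩, fun y hy => ?_⟩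
  · rw [h.eval_smul_conicForm, hq, hg, mul_zero, add_zero, mul_zero]
  · rwa [projL_joinVec]
  · obtain ⟨c, rfl⟩ := (HomCoords.mem_submodule_iff_of_mem_cone hmem).1 hy
    rw [smul_joinVec, projL_joinVec]
    exact p.submodule.smul_mem _ (p.submodule.smul_mem _ ha.2)

end IsNormalForm

end BlowUp

/-- `(u, v)` is a non-trivial zero of the quadratic form `A u² + 2 B u v + D v²`, and `y` is the
square root of `A D - B²` for which the symmetric matrix `(A, B; B, D)` maps `(u, v)` to
`i y (v, -u)`. The two square roots correspond to the two linear factors of the form. -/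
structure IsBinaryRoot (A B D u v y : ℂ) : Prop where
  ne_zero : u ≠ 0 ∨ v ≠ 0
  eq₁ : A * u + B * v = Complex.I * y * v
  eq₂ : B * u + D * v = -(Complex.I * y * u)

namespace IsBinaryRoot

variable {A B D u v y : ℂ}

theorem sq_eq (h : IsBinaryRoot A B D u v y) : y ^ 2 = A * D - B ^ 2 := by
  rcases h.ne_zero with hu | hv
  · apply mul_right_cancel₀ hu
    linear_combination (-D) * h.eq₁ + (B - Complex.I * y) * h.eq₂ + y ^ 2 * u * Complex.I_sq
  · apply mul_right_cancel₀ hv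
    linear_combination (B + Complex.I * y) * h.eq₁ - A * h.eq₂ + y ^ 2 * v * Complex.I_sq

theorem quadratic_eq_zero (h : IsBinaryRoot A B D u v y) :
    A * u ^ 2 + D * v ^ 2 + 2 * B * u * v = 0 := by
  linear_combination u * h.eq₁ + v * h.eq₂

theorem smul (h : IsBinaryRoot A B D u v y) {c : ℂ} (hc : c ≠ 0) :
    IsBinaryRoot A B D (c * u) (c * v) y where
  ne_zero := h.ne_zero.imp (mul_ne_zero hc) (mul_ne_zero hc)
  eq₁ := by linear_combination c * h.eq₁
  eq₂ := by linear_combination c * h.eq₂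

theorem smul_form (h : IsBinaryRoot A B D u v y) (c : ℂ) :
    IsBinaryRoot (c * A) (c * B) (c * D) u v (c * y) where
  ne_zero := h.ne_zero
  eq₁ := by linear_combination c * h.eq₁
  eq₂ := by linear_combination c * h.eq₂

theorem exists_of_quadratic_eq_zero (huv : u ≠ 0 ∨ v ≠ 0)
    (hq : A * u ^ 2 + D * v ^ 2 + 2 * B * u * v = 0) : ∃ y, IsBinaryRoot A B D u v y := by
  rcases huv with hu | hv
  · refine ⟨Complex.I * (B * u + D * v) / u, Or.inl hu, ?_, ?_⟩ <;> field_simp <;>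
      rw [Complex.I_sq]
    · linear_combination hq
    · ring
  · refine ⟨-Complex.I * (A * u + B * v) / v, Or.inr hv, ?_, ?_⟩ <;> field_simp <;>
      rw [Complex.I_sq]
    · ring
    · linear_combination hq

theorem root_unique {y' : ℂ} (h : IsBinaryRoot A B D u v y) (h' : IsBinaryRoot A B D u v y') :
    y' = y := by
  rcases h.ne_zero with hu | hv
  · apply mul_left_cancel₀ (mul_ne_zero Complex.I_ne_zero hu)
    linear_combination h'.eq₂ - h.eq₂
  · apply mul_left_cancel₀ (mul_ne_zero Complex.I_ne_zero hv)
    linear_combination h.eq₁ - h'.eq₁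

section NonIsotropic

variable {b c : ℂ} (hbc : A * b ^ 2 + D * c ^ 2 + 2 * B * b * c ≠ 0)

include hbc

/-- If `S` is the symmetric matrix and `J (u, v) = (v, -u)`, then the asserted zero is
`-(J⁻¹ S + i y) (b, c)`, which is an eigenvector of `J⁻¹ S` since `(J⁻¹ S)² = -y²`. -/
theorem of_sq_eq (hy : y ^ 2 = A * D - B ^ 2) :
    IsBinaryRoot A B D (B * b + D * c - Complex.I * b * y)
      (-(A * b + B * c + Complex.I * c * y)) y where
  ne_zero := by
    by_contra! h₀
    exact hbc (by linear_combination c * h₀.1 - b * h₀.2)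
  eq₁ := by linear_combination (-c) * hy + c * y ^ 2 * Complex.I_sq
  eq₂ := by linear_combination b * hy - b * y ^ 2 * Complex.I_sq

theorem exists_eq_mul (h : IsBinaryRoot A B D u v y) :
    ∃ t, t ≠ 0 ∧ B * b + D * c - Complex.I * b * y = t * u ∧
      -(A * b + B * c + Complex.I * c * y) = t * v := by
  have hu : (A * b ^ 2 + D * c ^ 2 + 2 * B * b * c) * u =
      (c * u - b * v) * (B * b + D * c - Complex.I * b * y) := by
    linear_combination b ^ 2 * h.eq₁ + b * c * h.eq₂
  have hv : (A * b ^ 2 + D * c ^ 2 + 2 * B * b * c) * v =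
      (c * u - b * v) * -(A * b + B * c + Complex.I * c * y) := by
    linear_combination b * c * h.eq₁ + c ^ 2 * h.eq₂
  have hne : c * u - b * v ≠ 0 := by
    intro h₀
    rw [h₀, zero_mul] at hu hv
    exact h.ne_zero.elim (fun hu₀ => mul_ne_zero hbc hu₀ hu) fun hv₀ => mul_ne_zero hbc hv₀ hv
  refine ⟨_, div_ne_zero hbc hne, ?_, ?_⟩ <;> rw [div_mul_eq_mul_div, eq_div_iff hne]
  · linear_combination -hu
  · linear_combination -hv

end NonIsotropic

end IsBinaryRoot

section Span

variable {a : Fin 3 → ℂ} {u v : ℂ}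

theorem mem_span_joinVec_pair {x : Fin 5 → ℂ} :
    x ∈ Submodule.span ℂ {joinVec a 0 0, joinVec 0 u v} ↔
      ∃ s t : ℂ, joinVec (s • a) (t * u) (t * v) = x := by
  simp only [Submodule.mem_span_pair, smul_joinVec, joinVec_add, mul_zero, smul_zero, add_zero,
    zero_add]

theorem linearIndependent_joinVec_pair (ha : a ≠ 0) (huv : u ≠ 0 ∨ v ≠ 0) :
    LinearIndependent ℂ ![joinVec a 0 0, joinVec 0 u v] := by
  refine LinearIndependent.pair_iff.2 fun s t h => ?_
  simp only [smul_joinVec, joinVec_add, mul_zero, smul_zero, add_zero, zero_add,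
    joinVec_eq_zero_iff] at h
  exact ⟨(smul_eq_zero.1 h.1).resolve_right ha, huv.elim
    (fun hu => (mul_eq_zero.1 h.2.1).resolve_right hu)
    fun hv => (mul_eq_zero.1 h.2.2).resolve_right hv⟩

theorem finrank_span_joinVec_pair (ha : a ≠ 0) (huv : u ≠ 0 ∨ v ≠ 0) :
    Module.finrank ℂ (Submodule.span ℂ {joinVec a 0 0, joinVec 0 u v}) = 2 := by
  have := finrank_span_eq_card (linearIndependent_joinVec_pair ha huv)
  rwa [Matrix.range_cons_cons_empty] at this

theorem span_joinVec_pair_smul {s t : ℂ} (hs : s ≠ 0) (ht : t ≠ 0) :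
    Submodule.span ℂ {joinVec (s • a) 0 0, joinVec 0 (t * u) (t * v)} =
      Submodule.span ℂ {joinVec a 0 0, joinVec 0 u v} := by
  have hsa : joinVec (s • a) 0 0 = s • joinVec a 0 0 := by rw [smul_joinVec, mul_zero]
  have htu : joinVec 0 (t * u) (t * v) = t • joinVec 0 u v := by rw [smul_joinVec, smul_zero]
  rw [Submodule.span_insert, Submodule.span_insert, hsa, htu,
    Submodule.span_singleton_smul_eq hs.isUnit, Submodule.span_singleton_smul_eq ht.isUnit]

variable {m : Submodule ℂ (Fin 5 → ℂ)}

/-- Otherwise `x ↦ (x₃, x₄)` would map `m` isomorphically onto the plane, so that `m` would contain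
a point over the given `(b, c)`. -/
theorem joinVec_vertex_mem (hm : Module.finrank ℂ m = 2) (hma : ∀ x ∈ m, ∃ t : ℂ, projL x = t • a)
    {b c : ℂ} (hbc : ∀ x ∈ m, ¬(x 3 = b ∧ x 4 = c)) : joinVec a 0 0 ∈ m := by
  let T : m →ₗ[ℂ] Fin 2 → ℂ := (LinearMap.funLeft ℂ ℂ ![3, 4]).domRestrict m
  have hT : ¬Function.Injective T := fun hinj => by
    obtain ⟨x, hx⟩ := (LinearMap.injective_iff_surjective_of_finrank_eq_finrank
      (by rw [hm, Module.finrank_fin_fun])).1 hinj ![b, c]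
    exact hbc x.1 x.2 ⟨congrFun hx 0, congrFun hx 1⟩
  rw [← LinearMap.ker_eq_bot, Submodule.eq_bot_iff] at hT
  push Not at hT
  obtain ⟨⟨x, hxm⟩, hx, hx₀⟩ := hT
  obtain ⟨t, ht⟩ := hma x hxm
  have hxt : x = t • joinVec a 0 0 := by
    rw [← joinVec_projL x, show x 3 = 0 from congrFun hx 0, show x 4 = 0 from congrFun hx 1, ht,
      smul_joinVec, mul_zero]
  have ht₀ : t ≠ 0 := by
    rintro rfl
    exact hx₀ (Subtype.ext (hxt.trans (zero_smul ℂ _)))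
  rwa [hxt, m.smul_mem_iff ht₀] at hxm

theorem exists_eq_span_joinVec_pair (ha : a ≠ 0) (hm : Module.finrank ℂ m = 2)
    (hma : ∀ x ∈ m, ∃ t : ℂ, projL x = t • a) (hvertex : joinVec a 0 0 ∈ m) :
    ∃ u v : ℂ, (u ≠ 0 ∨ v ≠ 0) ∧ m = Submodule.span ℂ {joinVec a 0 0, joinVec 0 u v} := by
  obtain ⟨w, hw, hwa⟩ : ∃ w ∈ m, w ∉ Submodule.span ℂ {joinVec a 0 0} := by
    by_contra! hle
    have hrank := Submodule.finrank_mono hle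
    rw [hm, finrank_span_singleton (joinVec_eq_zero_iff.not.2 fun h₀ => ha h₀.1)] at hrank
    omega
  obtain ⟨t, ht⟩ := hma w hw
  have hw_eq : w = t • joinVec a 0 0 + joinVec 0 (w 3) (w 4) := by
    rw [smul_joinVec, joinVec_add, mul_zero, zero_add, zero_add, add_zero, ← ht, joinVec_projL]
  have huv : w 3 ≠ 0 ∨ w 4 ≠ 0 := by
    by_contra! h₀
    rw [h₀.1, h₀.2, joinVec_eq_zero_iff.2 ⟨rfl, rfl, rfl⟩, add_zero] at hw_eq
    exact hwa (Submodule.mem_span_singleton.2 ⟨t, hw_eq.symm⟩)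
  have hline : joinVec 0 (w 3) (w 4) ∈ m :=
    (m.add_mem_iff_right (m.smul_mem t hvertex)).1 (hw_eq ▸ hw)
  refine ⟨w 3, w 4, huv, (Submodule.eq_of_le_of_finrank_eq (Submodule.span_le.2 ?_) ?_).symm⟩
  · exact Set.insert_subset hvertex (Set.singleton_subset_iff.2 hline)
  · rw [finrank_span_joinVec_pair ha huv, hm]

end Span

section LineRep

variable {l₁ l₂ l₃ g : MvPolynomial (Fin 3) ℂ}

theorem IsNormalForm.discriminantCurve_eq (h : IsNormalForm l₁ l₂ l₃ g) :
    discriminantCurve l₁ l₂ l₃ g = hypersurface g ∪ hypersurface (l₁ * l₂ - l₃ ^ 2) := by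
  have hdet : (conicMatrix l₁ l₂ l₃ g).det = g * (l₁ * l₂ - l₃ ^ 2) := by
    simp only [conicMatrix, Matrix.det_fin_three, Matrix.of_apply, Matrix.cons_val',
      Matrix.cons_val]
    ring
  ext p
  obtain ⟨a, ha⟩ := (HomCoords.projSpace_wellFormed 3).nonempty p
  rw [discriminantCurve, hdet, Set.mem_union, mem_hypersurface_iff h.cubic ha,
    mem_hypersurface_iff (h.cubic.mul h.isHomogeneous_conic) ha,
    mem_hypersurface_iff h.isHomogeneous_conic ha, map_mul, mul_eq_zero]

/-- The point `z` of the double cover is `([a], m)`, where the line `m` is spanned by `(a, 0, 0)`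
and `(0, u, v)`, and `y` is the square root of `l₁ l₂ - l₃²` at `a` belonging to the linear factor
of the conic which vanishes on `m`. -/
structure IsLineRep (z : coverOfCubic l₁ l₂ l₃ g) (a : Fin 3 → ℂ) (u v y : ℂ) : Prop
    extends IsBinaryRoot (eval a l₁) (eval a l₃) (eval a l₂) u v y where
  mem_cone : a ∈ (HomCoords.projSpace 3).cone z.1.1
  span : z.1.2.1 = Submodule.span ℂ {joinVec a 0 0, joinVec 0 u v}

namespace IsLineRep

variable {z : coverOfCubic l₁ l₂ l₃ g} {a : Fin 3 → ℂ} {u v y : ℂ}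

theorem eval_cubic (hr : IsLineRep z a u v y) : eval a g = 0 := z.2.2 a hr.mem_cone.2

theorem root_sq_eq (hr : IsLineRep z a u v y) : y ^ 2 = eval a (l₁ * l₂ - l₃ ^ 2) := by
  rw [hr.sq_eq, map_sub, map_mul, map_pow]

theorem smul_kernel (hr : IsLineRep z a u v y) {c : ℂ} (hc : c ≠ 0) :
    IsLineRep z a (c * u) (c * v) y where
  toIsBinaryRoot := hr.smul hc
  mem_cone := hr.mem_cone
  span := by
    rw [hr.span]
    simpa only [one_smul] using (span_joinVec_pair_smul one_ne_zero hc).symm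

theorem smul_point (h : IsNormalForm l₁ l₂ l₃ g) (hr : IsLineRep z a u v y) {c : ℂ}
    (hc : c ≠ 0) : IsLineRep z (c • a) u v (c * y) where
  toIsBinaryRoot := by
    simpa only [eval_smul_of_isHomogeneous h.left, eval_smul_of_isHomogeneous h.mixed,
      eval_smul_of_isHomogeneous h.right, pow_one] using hr.smul_form c
  mem_cone := HomCoords.smul_mem_projSpace_cone hr.mem_cone hc
  span := by
    rw [hr.span]
    simpa only [one_mul] using (span_joinVec_pair_smul hc one_ne_zero).symm

theorem exists_scalar {a' : Fin 3 → ℂ} {u' v' y' : ℂ} (hr : IsLineRep z a u v y)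
    (hr' : IsLineRep z a' u' v' y') : ∃ t : ℂ, t ≠ 0 ∧ u' = t * u ∧ v' = t * v := by
  have hmem : joinVec 0 u' v' ∈ z.1.2.1 := hr'.span ▸ Submodule.subset_span (by simp)
  rw [hr.span, mem_span_joinVec_pair] at hmem
  obtain ⟨s, t, hst⟩ := hmem
  obtain ⟨-, rfl, rfl⟩ := joinVec_inj.1 hst
  exact ⟨t, hr'.ne_zero.elim left_ne_zero_of_mul left_ne_zero_of_mul, rfl, rfl⟩

theorem root_unique {u' v' y' : ℂ} (hr : IsLineRep z a u v y) (hr' : IsLineRep z a u' v' y') :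
    y' = y := by
  obtain ⟨t, ht, rfl, rfl⟩ := hr.exists_scalar hr'
  exact (hr.smul ht).root_unique hr'.toIsBinaryRoot

/-- The line is recovered from the square root by means of a non-isotropic vector `(b, c)`. -/
theorem recover (hr : IsLineRep z a u v y) {b c : ℂ}
    (hbc : eval a (conicForm l₁ l₂ l₃ b c) ≠ 0) :
    IsLineRep z a (eval a l₃ * b + eval a l₂ * c - Complex.I * b * y)
      (-(eval a l₁ * b + eval a l₃ * c + Complex.I * c * y)) y := by
  rw [eval_conicForm] at hbc
  obtain ⟨t, ht, hu, hv⟩ := IsBinaryRoot.exists_eq_mul hbc hr.toIsBinaryRoot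
  rw [hu, hv]
  exact hr.smul_kernel ht

theorem point_unique (h : HasConicFibres l₁ l₂ l₃ g) {z' : coverOfCubic l₁ l₂ l₃ g} {u' v' : ℂ}
    (hr : IsLineRep z a u v y) (hr' : IsLineRep z' a u' v' y) : z' = z := by
  obtain ⟨b, c, hbc⟩ := h.exists_conicForm_ne_zero a hr.mem_cone.1 hr.eval_cubic
  refine Subtype.ext (Prod.ext ?_ (Subtype.ext ?_))
  · exact HomCoords.eq_of_mem_projSpace_cone hr'.mem_cone hr.mem_cone
  · rw [(hr'.recover hbc).span, (hr.recover hbc).span]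

end IsLineRep

namespace HasConicFibres

variable {a : Fin 3 → ℂ}

theorem exists_isLineRep (h : HasConicFibres l₁ l₂ l₃ g) (z : coverOfCubic l₁ l₂ l₃ g)
    (ha : a ∈ (HomCoords.projSpace 3).cone z.1.1) : ∃ u v y, IsLineRep z a u v y := by
  have hg : eval a g = 0 := z.2.2 a ha.2
  have hblow {x : Fin 5 → ℂ} (hx : x ∈ z.1.2.1) (hx₀ : x ≠ 0) :=
    z.2.1.2 (Projectivization.mk ℂ x hx₀)
      (by rwa [Projectivization.submodule_mk, Submodule.span_singleton_le_iff_mem])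
  have hproj (x : Fin 5 → ℂ) (hx : x ∈ z.1.2.1) : ∃ t : ℂ, projL x = t • a := by
    rcases eq_or_ne x 0 with rfl | hx₀
    · exact ⟨0, by rw [zero_smul]; rfl⟩
    · exact exists_projL_eq_smul_of_mem_blowUpL (hblow hx hx₀)
        (HomCoords.mk_mem_projSpace_cone hx₀) ha
  have hconic (x : Fin 5 → ℂ) (hx : x ∈ z.1.2.1) :
      eval a (conicForm l₁ l₂ l₃ (x 3) (x 4)) = 0 := by
    rcases eq_or_ne x 0 with rfl | hx₀
    · simp [eval_conicForm]
    · exact h.eval_conicForm_eq_zero_of_mem_blowUpL (hblow hx hx₀)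
        (HomCoords.mk_mem_projSpace_cone hx₀) ha hg
  obtain ⟨b, c, hbc⟩ := h.exists_conicForm_ne_zero a ha.1 hg
  have hvertex := joinVec_vertex_mem z.1.2.2 hproj (b := b) (c := c) fun x hx hxbc =>
    hbc (hxbc.1 ▸ hxbc.2 ▸ hconic x hx)
  obtain ⟨u, v, huv, hspan⟩ := exists_eq_span_joinVec_pair ha.1 z.1.2.2 hproj hvertex
  have hq : eval a (conicForm l₁ l₂ l₃ u v) = 0 :=
    hconic (joinVec 0 u v) (hspan ▸ Submodule.subset_span (by simp))
  rw [eval_conicForm] at hq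
  obtain ⟨y, hy⟩ := IsBinaryRoot.exists_of_quadratic_eq_zero huv hq
  exact ⟨u, v, y, hy, ha, hspan⟩

theorem exists_point (h : HasConicFibres l₁ l₂ l₃ g) {p : ℙ ℂ (Fin 3 → ℂ)}
    (ha : a ∈ (HomCoords.projSpace 3).cone p) (hp : p ∈ hypersurface g) {y : ℂ}
    (hy : y ^ 2 = eval a (l₁ * l₂ - l₃ ^ 2)) :
    ∃ (z : coverOfCubic l₁ l₂ l₃ g) (u v : ℂ), z.1.1 = p ∧ IsLineRep z a u v y := by
  have hg : eval a g = 0 := hp a ha.2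
  obtain ⟨b, c, hbc⟩ := h.exists_conicForm_ne_zero a ha.1 hg
  rw [eval_conicForm] at hbc
  rw [map_sub, map_mul, map_pow] at hy
  have hroot := IsBinaryRoot.of_sq_eq hbc hy
  refine ⟨⟨⟨p, _, finrank_span_joinVec_pair ha.1 hroot.ne_zero⟩, ⟨?_, fun x hx => ?_⟩, hp⟩,
    _, _, rfl, hroot, ha, rfl⟩
  · rw [h.discriminantCurve_eq]
    exact Or.inl hp
  · obtain ⟨w, hw⟩ := (HomCoords.projSpace_wellFormed 5).nonempty x
    obtain ⟨s, t, rfl⟩ := mem_span_joinVec_pair.1 (hx hw.2)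
    refine h.mem_blowUpL_of_conic hw ha hg ?_
    rw [eval_conicForm]
    linear_combination t ^ 2 * hroot.quadratic_eq_zero

end HasConicFibres

end LineRep

/-! ### Coordinates on the double cover -/

section CoverCoordinates

variable {l₁ l₂ l₃ g : MvPolynomial (Fin 3) ℂ}

/-- Weight one coordinates on the double cover: coordinates `a` of the image point together with
the square root of `l₁ l₂ - l₃²` at `a` which belongs to the line. They present the double cover as
a closed subvariety of `ℙ³`. -/
noncomputable def rootCoords (l₁ l₂ l₃ g : MvPolynomial (Fin 3) ℂ) :
    HomCoords (coverOfCubic l₁ l₂ l₃ g) (Fin 3 ⊕ Unit) ℤ where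
  wt := fun _ => 1
  cone z := {w | ∃ u v, IsLineRep z (w ∘ Sum.inl) u v (w (Sum.inr ()))}

/-- The coordinates in `ℙ² × G(2, 5)` of `([a], m)`, where the line `m` is spanned by `(a, 0, 0)`
and `(0, u, v)`. -/
def coverVec (a : Fin 3 → ℂ) (u v : ℂ) : Fin 3 ⊕ Fin 5 × Fin 5 → ℂ :=
  Sum.elim a fun ij => joinVec a 0 0 ij.1 * joinVec 0 u v ij.2 -
    joinVec a 0 0 ij.2 * joinVec 0 u v ij.1

theorem cubicCoords_wellFormed (g : MvPolynomial (Fin 3) ℂ) : (cubicCoords g).WellFormed :=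
  (HomCoords.projSpace_wellFormed 3).restrict _

theorem coverOfCubicCoords_wellFormed : (coverOfCubicCoords l₁ l₂ l₃ g).WellFormed :=
  ((HomCoords.projSpace_wellFormed 3).prod HomCoords.grassmannian_wellFormed).restrict _

theorem cubicCoords_isProjective (hg : g.IsHomogeneous 3) :
    (cubicCoords g).IsProjective {g} where
  wt_eq_one _ := rfl
  cone_nonempty := (cubicCoords_wellFormed g).nonempty
  mem_cone_iff ha := HomCoords.mem_projSpace_cone_iff ha
  eq_of_mem_cone ha ha' := Subtype.ext (HomCoords.eq_of_mem_projSpace_cone ha ha')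
  exists_mem_cone_iff := by
    refine ⟨fun ⟨p, ha⟩ => ⟨ha.1, ?_⟩, fun ⟨ha₀, ha⟩ => ?_⟩
    · rintro _ rfl
      exact p.2 _ ha.2
    · have hmem := HomCoords.mk_mem_projSpace_cone ha₀
      exact ⟨⟨_, (mem_hypersurface_iff hg hmem).2 (ha g rfl)⟩, hmem⟩

namespace HasConicFibres

theorem existsUnique_root (h : HasConicFibres l₁ l₂ l₃ g) {z : coverOfCubic l₁ l₂ l₃ g}
    {a : Fin 3 → ℂ} (ha : a ∈ (HomCoords.projSpace 3).cone z.1.1) :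
    ∃! y, Sum.elim a (fun _ => y) ∈ (rootCoords l₁ l₂ l₃ g).cone z := by
  obtain ⟨u, v, y, hr⟩ := h.exists_isLineRep z ha
  exact ⟨y, ⟨u, v, hr⟩, fun y' ⟨_, _, hr'⟩ => hr.root_unique hr'⟩

theorem eq_of_mem_rootCoords_cone (h : HasConicFibres l₁ l₂ l₃ g)
    {z z' : coverOfCubic l₁ l₂ l₃ g} {w : Fin 3 ⊕ Unit → ℂ}
    (hw : w ∈ (rootCoords l₁ l₂ l₃ g).cone z) (hw' : w ∈ (rootCoords l₁ l₂ l₃ g).cone z') :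
    z = z' := by
  obtain ⟨_, _, hr⟩ := hw
  obtain ⟨_, _, hr'⟩ := hw'
  exact hr'.point_unique h hr

theorem existsUnique_point (h : HasConicFibres l₁ l₂ l₃ g) {p : hypersurface g} {a : Fin 3 → ℂ}
    {y : ℂ} (ha : a ∈ (cubicCoords g).cone p) (hy : y ^ 2 = eval a (l₁ * l₂ - l₃ ^ 2)) :
    ∃! z, coverMap l₁ l₂ l₃ g z = p ∧
      Sum.elim a (fun _ => y) ∈ (rootCoords l₁ l₂ l₃ g).cone z := by
  obtain ⟨z, u, v, hz, hr⟩ := h.exists_point ha p.2 hy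
  exact ⟨z, ⟨Subtype.ext hz, u, v, hr⟩, fun z' hz' =>
    h.eq_of_mem_rootCoords_cone hz'.2 ⟨u, v, hr⟩⟩

theorem rootCoords_isProjective (h : HasConicFibres l₁ l₂ l₃ g) :
    (rootCoords l₁ l₂ l₃ g).IsProjective
      {rename Sum.inl g, X (Sum.inr ()) ^ 2 - rename Sum.inl (l₁ * l₂ - l₃ ^ 2)} where
  wt_eq_one _ := rfl
  cone_nonempty z := by
    obtain ⟨a, ha⟩ := (HomCoords.projSpace_wellFormed 3).nonempty z.1.1
    exact ⟨_, (h.existsUnique_root ha).exists.choose_spec⟩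
  mem_cone_iff := by
    rintro z w w' ⟨u, v, hr⟩
    refine ⟨fun ⟨u', v', hr'⟩ => ?_, ?_⟩
    · obtain ⟨c, hc, hw'⟩ := (HomCoords.mem_projSpace_cone_iff hr.mem_cone).1 hr'.mem_cone
      rw [hw'] at hr'
      exact ⟨c, hc, funext (Sum.rec (congrFun hw') fun _ =>
        (hr.smul_point h.toIsNormalForm hc).root_unique hr')⟩
    · rintro ⟨c, hc, rfl⟩
      exact ⟨u, v, hr.smul_point h.toIsNormalForm hc⟩
  eq_of_mem_cone := h.eq_of_mem_rootCoords_cone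
  exists_mem_cone_iff {w} := by
    simp only [Set.mem_insert_iff, Set.mem_singleton_iff, forall_eq_or_imp, forall_eq, map_sub,
      map_pow, eval_X, eval_rename, sub_eq_zero]
    refine ⟨fun ⟨z, u, v, hr⟩ => ⟨?_, hr.eval_cubic, by
      rw [hr.root_sq_eq, map_sub, map_pow]⟩, fun ⟨hw₀, hg, hy⟩ => ?_⟩
    · rintro rfl
      exact hr.mem_cone.1 rfl
    · rw [← map_pow, ← map_sub] at hy
      have ha : w ∘ Sum.inl ≠ 0 := fun ha => hw₀ (funext (Sum.rec (congrFun ha) fun _ => by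
        rw [ha, ← zero_smul ℂ (0 : Fin 3 → ℂ), eval_smul_of_isHomogeneous h.isHomogeneous_conic,
          zero_pow two_ne_zero, zero_mul] at hy
        exact pow_eq_zero_iff two_ne_zero |>.1 hy))
      have hmem := HomCoords.mk_mem_projSpace_cone ha
      obtain ⟨z, u, v, -, hr⟩ :=
        h.exists_point hmem ((mem_hypersurface_iff h.cubic hmem).2 hg) hy
      exact ⟨z, u, v, hr⟩

theorem rootCoords_isRootCover (h : HasConicFibres l₁ l₂ l₃ g) :
    HomCoords.IsRootCover (rootCoords l₁ l₂ l₃ g) (cubicCoords g) (coverMap l₁ l₂ l₃ g) 1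
      (l₁ * l₂ - l₃ ^ 2) where
  wt_eq := funext (Sum.rec (fun _ => rfl) fun _ => rfl)
  wellFormed := h.rootCoords_isProjective.wellFormed
  base_wellFormed := cubicCoords_wellFormed g
  isWeightedHomogeneous := isWeightedHomogeneous_of_isHomogeneous (fun _ => rfl)
    h.isHomogeneous_conic
  comp_inl_mem := fun ⟨_, _, hr⟩ => hr.mem_cone
  sq_eq := fun ⟨_, _, hr⟩ => hr.root_sq_eq
  existsUnique_root := h.existsUnique_root
  existsUnique_point := h.existsUnique_point

theorem mem_coverOfCubicCoords_cone_iff (h : HasConicFibres l₁ l₂ l₃ g)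
    {z : coverOfCubic l₁ l₂ l₃ g} {w : Fin 3 ⊕ Fin 5 × Fin 5 → ℂ} :
    w ∈ (coverOfCubicCoords l₁ l₂ l₃ g).cone z ↔
      ∃ a u v y, IsLineRep z a u v y ∧ w = coverVec a u v := by
  have hmem {a : Fin 3 → ℂ} {u v y : ℂ} (hr : IsLineRep z a u v y) :
      (fun ij => coverVec a u v (Sum.inr ij)) ∈ grassmannian.cone z.1.2 :=
    ⟨_, _, linearIndependent_joinVec_pair hr.mem_cone.1 hr.ne_zero, hr.span.symm, rfl⟩
  refine ⟨fun ⟨ha, hω⟩ => ?_, ?_⟩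
  · obtain ⟨u, v, y, hr⟩ := h.exists_isLineRep z ha
    obtain ⟨c, hc, hωc⟩ := HomCoords.grassmannian_cone_smul (hmem hr) hω
    refine ⟨_, _, _, _, hr.smul_kernel hc, funext (Sum.rec (fun _ => rfl) fun ij => ?_)⟩
    have hcuv : joinVec 0 (c * u) (c * v) = c • joinVec 0 u v := by rw [smul_joinVec, smul_zero]
    rw [congrFun hωc ij]
    simp only [coverVec, Sum.elim_inr, hcuv, Pi.smul_apply, smul_eq_mul]
    ring
  · rintro ⟨a, u, v, y, hr, rfl⟩
    exact ⟨hr.mem_cone, hmem hr⟩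

end HasConicFibres

theorem coverVec_inr_three (a : Fin 3 → ℂ) (u v : ℂ) (i : Fin 3) :
    coverVec a u v (Sum.inr (Fin.castLE (by norm_num) i, 3)) = a i * u := by
  simp only [coverVec, Sum.elim_inr, joinVec_castLE, joinVec_three, zero_mul, sub_zero]

theorem coverVec_inr_four (a : Fin 3 → ℂ) (u v : ℂ) (i : Fin 3) :
    coverVec a u v (Sum.inr (Fin.castLE (by norm_num) i, 4)) = a i * v := by
  simp only [coverVec, Sum.elim_inr, joinVec_castLE, joinVec_four, zero_mul, sub_zero]

/-- The defining equations of the root express it as a quotient by `u` or `v`, and `aᵢ u` and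
`aᵢ v` are Plücker coordinates. -/
theorem IsNormalForm.exists_root_quotient (h : IsNormalForm l₁ l₂ l₃ g)
    {a₀ : Fin 3 → ℂ} {u₀ v₀ : ℂ} (ha₀ : a₀ ≠ 0) (huv₀ : u₀ ≠ 0 ∨ v₀ ≠ 0) :
    ∃ D N : MvPolynomial (Fin 3 ⊕ Fin 5 × Fin 5) ℂ,
      IsWeightedHomogeneous (coverOfCubicCoords l₁ l₂ l₃ g).wt D ((0 : ℤ), (1 : ℤ)) ∧
      IsWeightedHomogeneous (coverOfCubicCoords l₁ l₂ l₃ g).wt N ((1 : ℤ), (1 : ℤ)) ∧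
      eval (coverVec a₀ u₀ v₀) D ≠ 0 ∧
      ∀ {z : coverOfCubic l₁ l₂ l₃ g} {a u v y}, IsLineRep z a u v y →
        eval (coverVec a u v) N = y * eval (coverVec a u v) D := by
  obtain ⟨i, hi⟩ := Function.ne_iff.1 ha₀
  set wt := (coverOfCubicCoords l₁ l₂ l₃ g).wt
  have hR (ij : Fin 5 × Fin 5) : IsWeightedHomogeneous wt (X (Sum.inr ij) : MvPolynomial _ ℂ)
      ((0 : ℤ), (1 : ℤ)) := isWeightedHomogeneous_X ℂ _ _
  have hL {l : MvPolynomial (Fin 3) ℂ} (hl : l.IsHomogeneous 1) :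
      IsWeightedHomogeneous wt (rename Sum.inl l) ((1 : ℤ), (0 : ℤ)) := by
    simpa only [one_smul] using isWeightedHomogeneous_rename_of_isHomogeneous
      (w := wt) (f := Sum.inl) (m := ((1 : ℤ), (0 : ℤ))) (fun _ => rfl) hl
  have hinl (a : Fin 3 → ℂ) (u v : ℂ) : coverVec a u v ∘ Sum.inl = a := rfl
  let U : MvPolynomial (Fin 3 ⊕ Fin 5 × Fin 5) ℂ := X (Sum.inr (Fin.castLE (by norm_num) i, 3))
  let V : MvPolynomial (Fin 3 ⊕ Fin 5 × Fin 5) ℂ := X (Sum.inr (Fin.castLE (by norm_num) i, 4))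
  rcases huv₀ with hu₀ | hv₀
  · refine ⟨U, C Complex.I * (rename Sum.inl l₃ * U + rename Sum.inl l₂ * V), hR _,
      (((hL h.mixed).mul (hR _)).add ((hL h.right).mul (hR _))).C_mul _, ?_,
      fun {_ a u v y} hr => ?_⟩
    · rw [eval_X, coverVec_inr_three]
      exact mul_ne_zero hi hu₀
    · simp only [U, V, map_mul, map_add, eval_X, eval_C, coverVec_inr_three, coverVec_inr_four,
        eval_rename, hinl]
      linear_combination Complex.I * a i * hr.eq₂ - y * a i * u * Complex.I_sq
  · refine ⟨V, C (-Complex.I) * (rename Sum.inl l₁ * U + rename Sum.inl l₃ * V), hR _,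
      (((hL h.left).mul (hR _)).add ((hL h.mixed).mul (hR _))).C_mul _, ?_,
      fun {_ a u v y} hr => ?_⟩
    · rw [eval_X, coverVec_inr_four]
      exact mul_ne_zero hi hv₀
    · simp only [U, V, map_mul, map_add, eval_X, eval_C, coverVec_inr_three, coverVec_inr_four,
        eval_rename, hinl]
      linear_combination -Complex.I * a i * hr.eq₁ - y * a i * v * Complex.I_sq

theorem HasConicFibres.locallyRational_cover_root (h : HasConicFibres l₁ l₂ l₃ g) :
    HomCoords.LocallyRational (coverOfCubicCoords l₁ l₂ l₃ g) (rootCoords l₁ l₂ l₃ g) id := by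
  refine ⟨AddMonoidHom.inl ℤ ℤ, fun z₀ => ?_⟩
  obtain ⟨a₀, ha₀⟩ := (HomCoords.projSpace_wellFormed 3).nonempty z₀.1.1
  obtain ⟨u₀, v₀, y₀, hr₀⟩ := h.exists_isLineRep z₀ ha₀
  obtain ⟨D, N, hD, hN, hD₀, hND⟩ := h.exists_root_quotient ha₀.1 hr₀.ne_zero
  refine ⟨_, D, Sum.elim (fun j => X (Sum.inl j) * D) fun _ => N, hD, ?_,
    (coverOfCubicCoords_wellFormed.mem_basicOpen_iff
      (h.mem_coverOfCubicCoords_cone_iff.2 ⟨_, _, _, _, hr₀, rfl⟩) hD).2 hD₀, fun z x hx hDx => ?_⟩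
  · rintro (j | _)
    · exact (isWeightedHomogeneous_X ℂ _ _).mul hD
    · exact hN
  · obtain ⟨a, u, v, y, hr, rfl⟩ := h.mem_coverOfCubicCoords_cone_iff.1 hx
    refine ⟨u, v, ?_⟩
    change IsLineRep z _ u v _
    convert hr using 1
    · funext j
      simp only [Function.comp_apply, Sum.elim_inl, map_mul, eval_X, mul_div_cancel_right₀ _ hDx]
      rfl
    · simp only [Sum.elim_inr, hND hr, mul_div_cancel_right₀ _ hDx]

/-- The point `(a, 0, 0)` of the line, with coordinates that are polynomials in the weight one
coordinates of the double cover. -/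
noncomputable def vertexPoly : Fin 5 → MvPolynomial (Fin 3 ⊕ Unit) ℂ :=
  ![X (Sum.inl 0), X (Sum.inl 1), X (Sum.inl 2), 0, 0]

/-- The point `(0, u, v)` of the line, recovered as in `IsLineRep.recover` from a non-isotropic
vector `(b, c)`, with coordinates that are polynomials in the weight one coordinates of the double
cover. -/
noncomputable def axisPoly (l₁ l₂ l₃ : MvPolynomial (Fin 3) ℂ) (b c : ℂ) :
    Fin 5 → MvPolynomial (Fin 3 ⊕ Unit) ℂ :=
  ![0, 0, 0, C b * rename Sum.inl l₃ + C c * rename Sum.inl l₂ -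
      C (Complex.I * b) * X (Sum.inr ()),
    -(C b * rename Sum.inl l₁ + C c * rename Sum.inl l₃ + C (Complex.I * c) * X (Sum.inr ()))]

theorem isWeightedHomogeneous_vertexPoly (i : Fin 5) :
    IsWeightedHomogeneous (rootCoords l₁ l₂ l₃ g).wt (vertexPoly i) (1 : ℤ) := by
  have hX (i : Fin 3 ⊕ Unit) := isWeightedHomogeneous_X ℂ (rootCoords l₁ l₂ l₃ g).wt i
  have h0 := isWeightedHomogeneous_zero ℂ (rootCoords l₁ l₂ l₃ g).wt (1 : ℤ)
  fin_cases i
  exacts [hX _, hX _, hX _, h0, h0]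

theorem eval_vertexPoly (w : Fin 3 ⊕ Unit → ℂ) (i : Fin 5) :
    eval w (vertexPoly i) = joinVec (w ∘ Sum.inl) 0 0 i := by
  fin_cases i <;> simp [vertexPoly, joinVec]

theorem isWeightedHomogeneous_rootCoords_rename_inl {l : MvPolynomial (Fin 3) ℂ}
    (hl : l.IsHomogeneous 1) :
    IsWeightedHomogeneous (rootCoords l₁ l₂ l₃ g).wt (rename Sum.inl l) (1 : ℤ) := by
  simpa only [one_smul] using isWeightedHomogeneous_rename_of_isHomogeneous
    (w := (rootCoords l₁ l₂ l₃ g).wt) (f := Sum.inl) (m := (1 : ℤ)) (fun _ => rfl) hl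

theorem IsNormalForm.isWeightedHomogeneous_axisPoly (h : IsNormalForm l₁ l₂ l₃ g) (b c : ℂ)
    (i : Fin 5) :
    IsWeightedHomogeneous (rootCoords l₁ l₂ l₃ g).wt (axisPoly l₁ l₂ l₃ b c i) (1 : ℤ) := by
  have hX := isWeightedHomogeneous_X ℂ (rootCoords l₁ l₂ l₃ g).wt (Sum.inr ())
  have hl {l : MvPolynomial (Fin 3) ℂ} (hl : l.IsHomogeneous 1) :
      IsWeightedHomogeneous (rootCoords l₁ l₂ l₃ g).wt (rename Sum.inl l) (1 : ℤ) :=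
    isWeightedHomogeneous_rootCoords_rename_inl hl
  have h0 := isWeightedHomogeneous_zero ℂ (rootCoords l₁ l₂ l₃ g).wt (1 : ℤ)
  fin_cases i
  exacts [h0, h0, h0, (((hl h.mixed).C_mul b).add ((hl h.right).C_mul c)).sub (hX.C_mul _),
    ((((hl h.left).C_mul b).add ((hl h.mixed).C_mul c)).add (hX.C_mul _)).neg]

theorem eval_axisPoly (b c : ℂ) (w : Fin 3 ⊕ Unit → ℂ) (i : Fin 5) :
    eval w (axisPoly l₁ l₂ l₃ b c i) = joinVec 0
      (eval (w ∘ Sum.inl) l₃ * b + eval (w ∘ Sum.inl) l₂ * c - Complex.I * b * w (Sum.inr ()))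
      (-(eval (w ∘ Sum.inl) l₁ * b + eval (w ∘ Sum.inl) l₃ * c +
        Complex.I * c * w (Sum.inr ()))) i := by
  fin_cases i <;> simp [axisPoly, joinVec, eval_rename] <;> ring

namespace HasConicFibres

theorem locallyRational_root_cover (h : HasConicFibres l₁ l₂ l₃ g) :
    HomCoords.LocallyRational (rootCoords l₁ l₂ l₃ g) (coverOfCubicCoords l₁ l₂ l₃ g) id := by
  refine ⟨AddMonoidHom.coprod (AddMonoidHom.id ℤ) (AddMonoidHom.id ℤ), fun z₀ => ?_⟩
  obtain ⟨a₀, ha₀⟩ := (HomCoords.projSpace_wellFormed 3).nonempty z₀.1.1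
  obtain ⟨u₀, v₀, y₀, hr₀⟩ := h.exists_isLineRep z₀ ha₀
  obtain ⟨b, c, hbc⟩ := h.exists_conicForm_ne_zero a₀ ha₀.1 hr₀.eval_cubic
  let D : MvPolynomial (Fin 3 ⊕ Unit) ℂ := rename Sum.inl (conicForm l₁ l₂ l₃ b c)
  let A := vertexPoly
  let W := axisPoly l₁ l₂ l₃ b c
  have hD : IsWeightedHomogeneous (rootCoords l₁ l₂ l₃ g).wt D (1 : ℤ) :=
    isWeightedHomogeneous_rootCoords_rename_inl (h.isHomogeneous_conicForm b c)
  have hA (i : Fin 5) : IsWeightedHomogeneous (rootCoords l₁ l₂ l₃ g).wt (A i) (1 : ℤ) :=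
    isWeightedHomogeneous_vertexPoly i
  have hW (i : Fin 5) : IsWeightedHomogeneous (rootCoords l₁ l₂ l₃ g).wt (W i) (1 : ℤ) :=
    h.isWeightedHomogeneous_axisPoly b c i
  refine ⟨(1 : ℤ), D, Sum.elim (fun j => X (Sum.inl j) * D)
    (fun ij => A ij.1 * W ij.2 - A ij.2 * W ij.1), hD, ?_, ?_, ?_⟩
  · rintro (j | ij)
    · exact (isWeightedHomogeneous_X ℂ _ _).mul hD
    · exact ((hA _).mul (hW _)).sub ((hA _).mul (hW _))
  · refine (h.rootCoords_isProjective.wellFormed.mem_basicOpen_iff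
      (x := Sum.elim a₀ fun _ => y₀) ⟨_, _, hr₀⟩ hD).2 ?_
    rwa [eval_rename, Sum.elim_comp_inl]
  · rintro z x ⟨u, v, hr⟩ hDx
    have hbc' := hDx
    rw [eval_rename] at hbc'
    refine h.mem_coverOfCubicCoords_cone_iff.2
      ⟨_, _, _, _, (hr.recover hbc').smul_kernel (inv_ne_zero hDx),
        funext (Sum.rec (fun i => ?_) fun ij => ?_)⟩
    · simp only [Sum.elim_inl, map_mul, eval_X, mul_div_cancel_right₀ _ hDx]
      rfl
    · have hsmul (u v : ℂ) : joinVec 0 ((eval x D)⁻¹ * u) ((eval x D)⁻¹ * v) =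
          (eval x D)⁻¹ • joinVec 0 u v := by rw [smul_joinVec, smul_zero]
      simp only [coverVec, Sum.elim_inr, hsmul, Pi.smul_apply, smul_eq_mul, map_sub, map_mul, A, W,
        eval_vertexPoly, eval_axisPoly]
      field_simp

end HasConicFibres

theorem locallyRational_root_cubic :
    HomCoords.LocallyRational (rootCoords l₁ l₂ l₃ g) (cubicCoords g) (coverMap l₁ l₂ l₃ g) := by
  refine ⟨AddMonoidHom.id ℤ, fun _ => ⟨0, 1, fun j => X (Sum.inl j),
    isWeightedHomogeneous_one _ _, fun j => isWeightedHomogeneous_X ℂ _ _, fun _ _ => by simp, ?_⟩⟩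
  rintro z x ⟨u, v, hr⟩ -
  simp only [eval_X, map_one, div_one]
  exact hr.mem_cone

namespace HasConicFibres

theorem isMorphism_cover_root (h : HasConicFibres l₁ l₂ l₃ g) :
    HomCoords.IsMorphism (coverOfCubicCoords l₁ l₂ l₃ g) (rootCoords l₁ l₂ l₃ g) id :=
  h.locallyRational_cover_root.isMorphism coverOfCubicCoords_wellFormed
    h.rootCoords_isProjective.wellFormed

theorem isMorphism_root_cover (h : HasConicFibres l₁ l₂ l₃ g) :
    HomCoords.IsMorphism (rootCoords l₁ l₂ l₃ g) (coverOfCubicCoords l₁ l₂ l₃ g) id :=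
  h.locallyRational_root_cover.isMorphism h.rootCoords_isProjective.wellFormed
    coverOfCubicCoords_wellFormed

theorem isMorphism_root_cubic (h : HasConicFibres l₁ l₂ l₃ g) :
    HomCoords.IsMorphism (rootCoords l₁ l₂ l₃ g) (cubicCoords g) (coverMap l₁ l₂ l₃ g) :=
  locallyRational_root_cubic.isMorphism h.rootCoords_isProjective.wellFormed
    (cubicCoords_wellFormed g)

theorem isMorphism_coverMap (h : HasConicFibres l₁ l₂ l₃ g) :
    HomCoords.IsMorphism (coverOfCubicCoords l₁ l₂ l₃ g) (cubicCoords g)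
      (coverMap l₁ l₂ l₃ g) :=
  h.isMorphism_root_cubic.comp h.isMorphism_cover_root

theorem regular_cover_eq_regular_root (h : HasConicFibres l₁ l₂ l₃ g)
    {V : Set (hypersurface g)} (hV : IsOpen[(cubicCoords g).zariski] V) :
    (coverOfCubicCoords l₁ l₂ l₃ g).regular (coverMap l₁ l₂ l₃ g ⁻¹' V) =
      (rootCoords l₁ l₂ l₃ g).regular (coverMap l₁ l₂ l₃ g ⁻¹' V) := by
  let _ := (cubicCoords g).zariski
  refine SetLike.ext fun f => ⟨fun hf => ?_, fun hf => ?_⟩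
  · let _ := (coverOfCubicCoords l₁ l₂ l₃ g).zariski
    exact h.isMorphism_root_cover.2 _ (hV.preimage h.isMorphism_coverMap.1) f hf
  · let _ := (rootCoords l₁ l₂ l₃ g).zariski
    exact h.isMorphism_cover_root.2 _ (hV.preimage h.isMorphism_root_cubic.1) f hf

theorem coverMap_preimage_basicOpen_X (h : HasConicFibres l₁ l₂ l₃ g) (i : Fin 3) :
    coverMap l₁ l₂ l₃ g ⁻¹' (cubicCoords g).basicOpen (X i) =
      (rootCoords l₁ l₂ l₃ g).basicOpen (X (Sum.inl i)) := by
  ext z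
  obtain ⟨w, hw⟩ := h.rootCoords_isProjective.cone_nonempty z
  have hw' := h.rootCoords_isRootCover.comp_inl_mem hw
  rw [Set.mem_preimage, h.rootCoords_isProjective.mem_basicOpen_X_iff hw,
    (cubicCoords_isProjective h.cubic).mem_basicOpen_X_iff hw']
  rfl

theorem isAffine_coverMap_preimage_basicOpen_X (h : HasConicFibres l₁ l₂ l₃ g) (i : Fin 3) :
    HomCoords.IsAffine ((coverOfCubicCoords l₁ l₂ l₃ g).restrict
      (coverMap l₁ l₂ l₃ g ⁻¹' (cubicCoords g).basicOpen (X i))) := by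
  rw [h.coverMap_preimage_basicOpen_X]
  have hroot := h.rootCoords_isProjective
  have hS := Set.mapsTo_id ((rootCoords l₁ l₂ l₃ g).basicOpen (X (Sum.inl i)))
  exact (hroot.isAffine_basicOpen_X _).of_isMorphism_id
    ((h.locallyRational_cover_root.restrict hS).isMorphism
      (coverOfCubicCoords_wellFormed.restrict _) (hroot.wellFormed.restrict _))
    ((h.locallyRational_root_cover.restrict hS).isMorphism (hroot.wellFormed.restrict _)
      (coverOfCubicCoords_wellFormed.restrict _))

theorem isAssociatedWith_coverMap (h : HasConicFibres l₁ l₂ l₃ g)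
    (hX : IsSmoothHypersurface (threefoldEq l₁ l₂ l₃ g)) :
    HomCoords.IsAssociatedWith (coverOfCubicCoords l₁ l₂ l₃ g) (cubicCoords g)
      (coverMap l₁ l₂ l₃ g) 1 ⟨_, HomCoords.eval_mem_sections
        h.rootCoords_isRootCover.isWeightedHomogeneous Set.univ⟩ :=
  ⟨(h.rootCoords_isRootCover.splitting (h.dense_basicOpen_conic hX)).ofRegularEq
    fun _ hV => h.regular_cover_eq_regular_root hV⟩

end HasConicFibres

theorem exists_trivialization_basicOpen_X (g : MvPolynomial (Fin 3) ℂ) (i : Fin 3) :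
    ∃ t ∈ (cubicCoords g).sections (-1) ((cubicCoords g).basicOpen (X i)),
      ∃ t' ∈ (cubicCoords g).sections 1 ((cubicCoords g).basicOpen (X i)), t * t' = 1 := by
  have hX : IsWeightedHomogeneous (cubicCoords g).wt (X i : MvPolynomial _ ℂ) (1 : ℤ) :=
    isWeightedHomogeneous_X ℂ _ i
  refine ⟨fun z => (z.2.1 i)⁻¹, fun p => ⟨1, 1, X i, isWeightedHomogeneous_one ℂ _, hX, p.2,
    fun z _ => ?_⟩, fun z => eval z.2.1 (X i), HomCoords.eval_mem_sections hX _, funext fun z => ?_⟩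
  · rw [map_one, eval_X, one_div]
  · have hz := z.1.2 _ z.2.2
    rw [eval_X] at hz
    simp only [Pi.mul_apply, eval_X, Pi.one_apply, inv_mul_cancel₀ hz]

namespace HasConicFibres

theorem isDoubleCover_coverMap (h : HasConicFibres l₁ l₂ l₃ g)
    (hX : IsSmoothHypersurface (threefoldEq l₁ l₂ l₃ g)) :
    HomCoords.IsDoubleCover (coverOfCubicCoords l₁ l₂ l₃ g) (cubicCoords g)
      (coverMap l₁ l₂ l₃ g) := by
  obtain ⟨S⟩ := h.isAssociatedWith_coverMap hX
  have hcubic := cubicCoords_isProjective h.cubic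
  refine S.isDoubleCover (cubicCoords_wellFormed g) h.isMorphism_coverMap fun p => ?_
  obtain ⟨a, ha⟩ := (cubicCoords_wellFormed g).nonempty p
  obtain ⟨i, hi⟩ := Function.ne_iff.1 ha.1
  exact ⟨_, (hcubic.mem_basicOpen_X_iff ha).2 hi,
    HomCoords.isOpen_basicOpen (hcubic.isWeightedHomogeneous_X i), hcubic.isAffine_basicOpen_X i,
    h.isAffine_coverMap_preimage_basicOpen_X i, exists_trivialization_basicOpen_X g i⟩

theorem branchLocus_coverMap (h : HasConicFibres l₁ l₂ l₃ g) :
    branchLocus (coverMap l₁ l₂ l₃ g) = {p | p.1 ∈ hypersurface (l₁ * l₂ - l₃ ^ 2)} := by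
  rw [h.rootCoords_isRootCover.branchLocus_eq]
  ext p
  obtain ⟨a, ha⟩ := (cubicCoords_wellFormed g).nonempty p
  exact ⟨fun hp => (mem_hypersurface_iff h.isHomogeneous_conic ha).2 (hp a ha),
    fun hp a ha => hp a ha.2⟩

end HasConicFibres

end CoverCoordinates

theorem mainTheorem9 (l₁ l₂ l₃ g : MvPolynomial (Fin 3) ℂ)
    (hl₁ : l₁.IsHomogeneous 1) (hl₂ : l₂.IsHomogeneous 1) (hl₃ : l₃.IsHomogeneous 1)
    (hg : g.IsHomogeneous 3) (hX : IsSmoothHypersurface (threefoldEq l₁ l₂ l₃ g)) :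
    IsSmoothHypersurface g ∧
    discriminantCurve l₁ l₂ l₃ g = hypersurface g ∪ hypersurface (l₁ * l₂ - l₃ ^ 2) ∧
    HomCoords.IsDoubleCover (coverOfCubicCoords l₁ l₂ l₃ g) (cubicCoords g)
      (coverMap l₁ l₂ l₃ g) ∧
    branchLocus (coverMap l₁ l₂ l₃ g) = {p | p.1 ∈ hypersurface (l₁ * l₂ - l₃ ^ 2)} ∧
    ∃ s : (cubicCoords g).sections (1 + 1) Set.univ,
      (∀ z, s.1 z = MvPolynomial.eval z.2.1 (l₁ * l₂ - l₃ ^ 2)) ∧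
      HomCoords.IsAssociatedWith (coverOfCubicCoords l₁ l₂ l₃ g) (cubicCoords g)
        (coverMap l₁ l₂ l₃ g) 1 s := by
  have hform : IsNormalForm l₁ l₂ l₃ g := ⟨hl₁, hl₂, hl₃, hg⟩
  have hfibres := hform.hasConicFibres hX
  exact ⟨isSmoothHypersurface_cubic hX, hform.discriminantCurve_eq,
    hfibres.isDoubleCover_coverMap hX, hfibres.branchLocus_coverMap, _, fun _ => rfl,
    hfibres.isAssociatedWith_coverMap hX⟩
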